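/- Let $n\ge 2$ and let $\Phi=\{\epsilon_a-\epsilon_b : 1\le a\ne b\le n+1\}$ be the root system of type $A_n$ in the hyperplane $X_{\mathbb R}\subset\mathbb R^{n+1}$ of vectors with coordinate sum zero, with positive roots $\Phi^+=\{\epsilon_a-\epsilon_b : a<b\}$, simple roots $\alpha_j=\epsilon_j-\epsilon_{j+1}$, weight lattice $X$, dominant weights $X^+$, half-sum of positive roots $\rho$, and finite Weyl group $W_f=S_{n+1}$ with length function $\ell$ and dot action $w\cdot\lambda=w(\lambda+\rho)-\rho$. The height of $\sum_j c_j\alpha_j$ is $\mathrm{ht}(\sum_j c_j\alpha_j)=\sum_j c_j$. Let $W_a$ be the affine Weyl group, generated by $S=\{s_{\alpha_1,0},\dots,s_{\alpha_n,0},s_{\beta,-1}\}$, where $\beta$ is the highest root and $s_{\alpha,m}(x)=x-(\langle x,\alpha^\vee\rangle-m)\alpha$. Let $\mathcal H$ be its Hecke algebra over $\mathbb Z[v,v^{-1}]$, with standard basis $\{\mathbf H_x\}$ normalized by $\mathbf H_s^2=1+(v^{-1}-v)\mathbf H_s$ for $s\in S$, and Kazhdan–Lusztig basis $\{\underline{\mathbf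 H}_x\}$, where $\underline{\mathbf H}_x$ is the unique bar-invariant element of $\mathbf H_x+\sum_y v\mathbb Z[v]\mathbf H_y$. Put $q=v^2$. Let $C_0=\{x\in X_{\mathbb R} : -1<\langle x,\alpha^\vee\rangle<0 \text{ for all } \alpha\in\Phi^+\}$ and let $w_0$ be the longest element of $W_f$. For $\lambda\in X$ let $\theta(\lambda)\in W_a$ be the unique element with $\theta(\lambda)(C_0)=w_0(C_0)+\lambda$. For $\lambda\in X^+$ let $\underline{\mathbf H}_\lambda:=\underline{\mathbf H}_{\theta(\lambda)}$, placed in the summand indexed by the class of $\lambda$ in $X/\mathbb Z\Phi$ of the spherical Hecke algebra $\widetilde{\mathcal H}=\bigoplus_{\sigma\in X/\mathbb Z\Phi}\mathcal H^\sigma$; here $\mathcal H^\sigma=\underline{\mathbf H}_{w_0}\mathcal H\cap\mathcal H\,\sigma(\underline{\mathbf H}_{w_0})\subset\mathcal H$, where $X/\mathbb Z\Phi$ acts on $\mathcal H$ through its identification with the group of length-zero elements of the extended affine Weyl group. Call $\lambda\in X$ regular if $\langle\lambda+\rho,\alpha^\vee\rangle\ne0$ for all $\alpha\in\Phi$, and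 singular otherwise. Put $\widetilde{\underline{\mathbf H}}_\lambda=(-1)^{\ell(w_\lambda)}\underline{\mathbf H}_{w_\lambda\cdot\lambda}$ if $\lambda$ is regular, where $w_\lambda\in W_f$ is the unique element with $w_\lambda\cdot\lambda\in X^+$, and $\widetilde{\underline{\mathbf H}}_\lambda=0$ if $\lambda$ is singular. For $i\ge2$ and $\lambda\in X^+$ the $i$-th pre-canonical basis element is $$\mathbf N^i_\lambda=\sum_{I\subseteq\{\alpha\in\Phi^+ :\ \mathrm{ht}(\alpha)\ge i\}}(-q)^{|I|}\,\widetilde{\underline{\mathbf H}}_{\lambda-\sum_{\alpha\in I}\alpha}.$$ For $\lambda,\mu\in X^+$ write $\mu\le_i\lambda$ if $\lambda-\mu$ is a linear combination with nonnegative integer coefficients of positive roots of height exactly $i$. **Theorem.** Let $i$ be an integer with $n/2+1\le i\le n$, and let $\lambda\in X^+$. Then there are only finitely many $\mu\in X^+$ with $\mu\le_i\lambda$, for each of them $\frac1i\mathrm{ht}(\lambda-\mu)$ is a nonnegative integer, and $$\mathbf N^{i+1}_\lambda=\sum_{\mu\in X^+,\ \mu\le_i\lambda}q^{\frac1i\mathrm{ht}(\lambda-\mu)}\,\mathbf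 N^i_\mu .$$ In particular, this expansion of $\mathbf N^{i+1}_\lambda$ is positive with monomial coefficients. -/

import Mathlib

noncomputable section

namespace PreCanonical

/-! ## Hecke algebras -/

/-- The ring of scalars `ℤ[v, v⁻¹]`. -/
abbrev Scalars : Type := LaurentPolynomial ℤ

/-- `v` to an integral power. -/
abbrev v (k : ℤ) : Scalars := LaurentPolynomial.T k

/-- The parameter `q = v²`. -/
abbrev q : Scalars := v 2

/-- The ring homomorphism from the free algebra that is `φ` on scalars and `f` on generators. -/
def freeLift {W A : Type} [Ring A] (φ : Scalars →+* A) (hφ : ∀ c x, φ c * x = x * φ c)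
    (f : W → A) : FreeAlgebra Scalars W →+* A :=
  letI : Algebra Scalars A := φ.toAlgebra' hφ
  (FreeAlgebra.lift Scalars f : FreeAlgebra Scalars W →ₐ[Scalars] A).toRingHom

theorem freeLift_ι {W A : Type} [Ring A] (φ : Scalars →+* A) (hφ : ∀ c x, φ c * x = x * φ c)
    (f : W → A) (x : W) : freeLift φ hφ f (FreeAlgebra.ι Scalars x) = f x := by
  let _ : Algebra Scalars A := φ.toAlgebra' hφ
  exact FreeAlgebra.lift_ι_apply f x

theorem freeLift_algebraMap {W A : Type} [Ring A] (φ : Scalars →+* A)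
    (hφ : ∀ c x, φ c * x = x * φ c) (f : W → A) (c : Scalars) :
    freeLift φ hφ f (algebraMap Scalars _ c) = φ c := by
  let _ : Algebra Scalars A := φ.toAlgebra' hφ
  exact AlgHom.commutes (FreeAlgebra.lift Scalars f : FreeAlgebra Scalars W →ₐ[Scalars] A) c

section Hecke

variable {W : Type} [Group W]

/-- The word length of `w` with respect to a set `S` of generators: the least `k` such that `w`
is a product of `k` elements of `S`. -/
def wordLength (S : Set W) (w : W) : ℕ :=
  sInf {k | ∃ l : List W, (∀ s ∈ l, s ∈ S) ∧ l.prod = w ∧ l.length = k}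

/-- `S` consists of elements of square one and generates `W`. -/
structure GeneratedByInvolutions (S : Set W) : Prop where
  sq : ∀ s ∈ S, s * s = 1
  gen : Submonoid.closure S = ⊤

/-- The Iwahori--Matsumoto relations: `H_x H_y = H_{xy}` if the lengths add up, and
`H_s² = 1 + (v⁻¹ - v) H_s` for `s ∈ S`. -/
inductive HeckeRel (S : Set W) : FreeAlgebra Scalars W → FreeAlgebra Scalars W → Prop
  | one : HeckeRel S (FreeAlgebra.ι Scalars 1) 1
  | mul (x y : W) (h : wordLength S (x * y) = wordLength S x + wordLength S y) :
      HeckeRel S (FreeAlgebra.ι Scalars x * FreeAlgebra.ι Scalars y)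
        (FreeAlgebra.ι Scalars (x * y))
  | quad (s : W) (hs : s ∈ S) :
      HeckeRel S (FreeAlgebra.ι Scalars s * FreeAlgebra.ι Scalars s)
        (1 + (v (-1) - v 1) • FreeAlgebra.ι Scalars s)

/-- The Hecke algebra over `ℤ[v, v⁻¹]` of the Coxeter group `W` with simple reflections `S`. -/
def HeckeAlgebra (S : Set W) : Type := RingQuot (HeckeRel S)

instance (S : Set W) : Ring (HeckeAlgebra S) := inferInstanceAs (Ring (RingQuot (HeckeRel S)))

instance (S : Set W) : Algebra Scalars (HeckeAlgebra S) :=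
  inferInstanceAs (Algebra Scalars (RingQuot (HeckeRel S)))

/-- The standard basis element `H_x`. -/
def stdH (S : Set W) (x : W) : HeckeAlgebra S :=
  RingQuot.mkAlgHom Scalars (HeckeRel S) (FreeAlgebra.ι Scalars x)

theorem stdH_one (S : Set W) : stdH S 1 = 1 := by
  have h := RingQuot.mkAlgHom_rel Scalars (HeckeRel.one (S := S))
  rw [map_one] at h
  exact h

theorem stdH_mul (S : Set W) (x y : W)
    (h : wordLength S (x * y) = wordLength S x + wordLength S y) :
    stdH S x * stdH S y = stdH S (x * y) := by
  have h := RingQuot.mkAlgHom_rel Scalars (HeckeRel.mul x y h)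
  rw [map_mul] at h
  exact h

theorem stdH_quad (S : Set W) (s : W) (hs : s ∈ S) :
    stdH S s * stdH S s = 1 + (v (-1) - v 1) • stdH S s := by
  have h := RingQuot.mkAlgHom_rel Scalars (HeckeRel.quad s hs)
  rw [map_mul, map_add, map_one, map_smul] at h
  exact h

theorem wordLength_le (S : Set W) (l : List W) (hl : ∀ s ∈ l, s ∈ S) :
    wordLength S l.prod ≤ l.length :=
  Nat.sInf_le ⟨l, hl, rfl, rfl⟩

theorem exists_word {S : Set W} (hS : GeneratedByInvolutions S) (w : W) :
    ∃ l : List W, (∀ s ∈ l, s ∈ S) ∧ l.prod = w ∧ l.length = wordLength S w := by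
  have hne : {k | ∃ l : List W, (∀ s ∈ l, s ∈ S) ∧ l.prod = w ∧ l.length = k}.Nonempty := by
    obtain ⟨l, hl, hp⟩ := Submonoid.exists_list_of_mem_closure
      (show w ∈ Submonoid.closure S by rw [hS.gen]; trivial)
    exact ⟨l.length, l, hl, hp, rfl⟩
  exact Nat.sInf_mem hne

theorem wordLength_inv {S : Set W} (hS : GeneratedByInvolutions S) (w : W) :
    wordLength S w⁻¹ = wordLength S w := by
  have key : ∀ w : W, wordLength S w⁻¹ ≤ wordLength S w := by
    intro w
    obtain ⟨l, hl, hp, hlen⟩ := exists_word hS w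
    have hmap : l.map (fun x => x⁻¹) = l := by
      conv_rhs => rw [← List.map_id l]
      exact List.map_congr_left fun s hs => inv_eq_of_mul_eq_one_left (hS.sq s (hl s hs))
    rw [← hlen, ← hp, List.prod_inv_reverse, hmap, ← List.length_reverse]
    exact wordLength_le S _ fun s hs => hl s (List.mem_reverse.1 hs)
  exact le_antisymm (key w) (by simpa using key w⁻¹)

theorem v_mul (a b : ℤ) : v a * v b = v (a + b) := (LaurentPolynomial.T_add a b).symm

theorem stdH_mul_inverse (S : Set W) (s : W) (hs : s ∈ S) :
    stdH S s * (stdH S s + (v 1 - v (-1)) • 1) = 1 := by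
  rw [mul_add, stdH_quad S s hs, mul_smul_comm, mul_one, add_assoc, ← add_smul]
  simp

theorem inverse_mul_stdH (S : Set W) (s : W) (hs : s ∈ S) :
    (stdH S s + (v 1 - v (-1)) • 1) * stdH S s = 1 := by
  rw [add_mul, stdH_quad S s hs, smul_mul_assoc, one_mul, add_assoc, ← add_smul]
  simp

theorem isUnit_stdH {S : Set W} (hS : GeneratedByInvolutions S) (x : W) :
    IsUnit (stdH S x) := by
  obtain ⟨l, hl, hp, hlen⟩ := exists_word hS x
  induction l generalizing x with
  | nil =>
    rw [← hp, List.prod_nil, stdH_one]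
    exact isUnit_one
  | cons s t ih =>
    have hs : s ∈ S := hl s (by simp)
    have ht : ∀ r ∈ t, r ∈ S := fun r hr => hl r (by simp [hr])
    have h1 : wordLength S t.prod ≤ t.length := wordLength_le S t ht
    have h2 : wordLength S s ≤ 1 := by simpa using wordLength_le S [s] (by simpa using hs)
    have h3 : wordLength S (s * t.prod) = t.length + 1 := by
      rw [← List.prod_cons, hp, ← hlen, List.length_cons]
    have h4 : wordLength S (s * t.prod) ≤ wordLength S s + wordLength S t.prod := by
      obtain ⟨l1, hl1, hp1, hn1⟩ := exists_word hS s
      obtain ⟨l2, hl2, hp2, hn2⟩ := exists_word hS t.prod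
      rw [← hn1, ← hn2, ← List.length_append]
      conv_lhs => rw [← hp1, ← hp2, ← List.prod_append]
      exact wordLength_le S _ fun r hr => (List.mem_append.1 hr).elim (hl1 r) (hl2 r)
    have h5 : wordLength S (s * t.prod) = wordLength S s + wordLength S t.prod := by omega
    rw [← hp, List.prod_cons, ← stdH_mul S _ _ h5]
    exact (IsUnit.mul ⟨⟨_, _, stdH_mul_inverse S s hs, inverse_mul_stdH S s hs⟩, rfl⟩
      (ih t.prod ht rfl (by omega)))

/-- The bar involution on the free algebra: `v ↦ v⁻¹` and `x ↦ (H_{x⁻¹})⁻¹`. -/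
def barFree (S : Set W) : FreeAlgebra Scalars W →+* HeckeAlgebra S :=
  freeLift
    ((algebraMap Scalars (HeckeAlgebra S)).comp
      (LaurentPolynomial.invert (R := ℤ)).toRingEquiv.toRingHom)
    (fun c x => Algebra.commutes (LaurentPolynomial.invert (R := ℤ) c) x)
    (fun x => Ring.inverse (stdH S x⁻¹))

theorem barFree_ι (S : Set W) (x : W) :
    barFree S (FreeAlgebra.ι Scalars x) = Ring.inverse (stdH S x⁻¹) :=
  freeLift_ι _ _ _ x

theorem barFree_algebraMap (S : Set W) (c : Scalars) :
    barFree S (algebraMap Scalars _ c) =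
      algebraMap Scalars (HeckeAlgebra S) (LaurentPolynomial.invert (R := ℤ) c) :=
  freeLift_algebraMap _ _ _ c

theorem barFree_rel {S : Set W} (hS : GeneratedByInvolutions S)
    ⦃a b : FreeAlgebra Scalars W⦄ (h : HeckeRel S a b) : barFree S a = barFree S b := by
  cases h with
  | one => rw [barFree_ι, map_one, inv_one, stdH_one, Ring.inverse_one]
  | mul x y h =>
    rw [map_mul, barFree_ι, barFree_ι, barFree_ι, mul_inv_rev]
    have hl : wordLength S (y⁻¹ * x⁻¹) = wordLength S y⁻¹ + wordLength S x⁻¹ := by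
      rw [← mul_inv_rev, wordLength_inv hS, wordLength_inv hS, wordLength_inv hS, h, add_comm]
    rw [← stdH_mul S _ _ hl]
    obtain ⟨u, hu⟩ := isUnit_stdH hS x⁻¹
    obtain ⟨w, hw⟩ := isUnit_stdH hS y⁻¹
    rw [← hu, ← hw, ← Units.val_mul, Ring.inverse_unit, Ring.inverse_unit, Ring.inverse_unit,
      mul_inv_rev, Units.val_mul]
  | quad s hs =>
    have hinv : s⁻¹ = s := inv_eq_of_mul_eq_one_left (hS.sq s hs)
    have hI : Ring.inverse (stdH S s) = stdH S s + (v 1 - v (-1)) • 1 :=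
      Ring.inverse_unit ⟨_, _, stdH_mul_inverse S s hs, inverse_mul_stdH S s hs⟩
    rw [map_mul, map_add, map_one, Algebra.smul_def, map_mul, barFree_algebraMap, barFree_ι, hinv,
      hI, ← Algebra.smul_def]
    have hT : LaurentPolynomial.invert (R := ℤ) (v (-1) - v 1) = v 1 - v (-1) := by
      simp
    rw [hT, mul_add, mul_smul_comm, mul_one, inverse_mul_stdH S s hs]

/-- The bar involution of the Hecke algebra, the ring homomorphism with `v ↦ v⁻¹` and
`H_x ↦ (H_{x⁻¹})⁻¹`. -/
def bar {S : Set W} (hS : GeneratedByInvolutions S) : HeckeAlgebra S →+* HeckeAlgebra S :=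
  RingQuot.lift ⟨barFree S, barFree_rel hS⟩

theorem bar_stdH {S : Set W} (hS : GeneratedByInvolutions S) (x : W) :
    bar hS (stdH S x) = Ring.inverse (stdH S x⁻¹) := by
  rw [← barFree_ι]
  have h : stdH S x = RingQuot.mkRingHom (HeckeRel S) (FreeAlgebra.ι Scalars x) := by
    rw [← RingQuot.mkAlgHom_coe Scalars (HeckeRel S)]
    rfl
  rw [h]
  exact RingQuot.lift_mkRingHom_apply (barFree S) (barFree_rel hS) _

theorem bar_algebraMap {S : Set W} (hS : GeneratedByInvolutions S) (c : Scalars) :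
    bar hS (algebraMap Scalars _ c) =
      algebraMap Scalars (HeckeAlgebra S) (LaurentPolynomial.invert (R := ℤ) c) := by
  rw [← barFree_algebraMap]
  have h : algebraMap Scalars (HeckeAlgebra S) c =
      RingQuot.mkRingHom (HeckeRel S) (algebraMap Scalars _ c) := by
    have h1 := (RingQuot.mkAlgHom Scalars (HeckeRel S)).commutes c
    rw [← RingQuot.mkAlgHom_coe Scalars (HeckeRel S)]
    exact h1.symm
  rw [h]
  exact RingQuot.lift_mkRingHom_apply (barFree S) (barFree_rel hS) _

/-- `b` is self-dual and lies in `H_x + ∑_y v ℤ[v] H_y`. -/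
def IsKazhdanLusztig {S : Set W} (hS : GeneratedByInvolutions S) (x : W) (b : HeckeAlgebra S) :
    Prop :=
  bar hS b = b ∧
    b - stdH S x ∈ AddSubgroup.closure {h | ∃ (y : W) (k : ℕ), h = v (k + 1) • stdH S y}

/-- The Kazhdan--Lusztig basis element of `x`, the unique element with `IsKazhdanLusztig`. -/
def klH {S : Set W} (hS : GeneratedByInvolutions S) (x : W) : HeckeAlgebra S :=
  Classical.epsilon (IsKazhdanLusztig hS x)

end Hecke

/-! ## Roots and weights of type `A_n` -/

/-- The Euclidean coordinate space `ℝⁿ⁺¹`. -/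
abbrev Coord (n : ℕ) : Type := Fin (n + 1) → ℝ

/-- The hyperplane `X_ℝ ⊂ ℝⁿ⁺¹` of vectors whose coordinates add up to zero. -/
def realWeights (n : ℕ) : Submodule ℝ (Coord n) where
  carrier := {x | ∑ a, x a = 0}
  add_mem' := by
    intro x y hx hy
    simp only [Set.mem_ofPred_eq, Pi.add_apply, Finset.sum_add_distrib] at *
    rw [hx, hy, add_zero]
  zero_mem' := by simp
  smul_mem' := by
    intro c x hx
    simp only [Set.mem_ofPred_eq, Pi.smul_apply, smul_eq_mul, ← Finset.mul_sum] at *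
    rw [hx, mul_zero]

/-- The vector `ε_a - ε_b` (a root if `a ≠ b`, a positive root if `a < b`). -/
def rootVec (n : ℕ) (a b : Fin (n + 1)) : Coord n := Pi.single a 1 - Pi.single b 1

/-- The pairing `⟨x, (ε_a - ε_b)^∨⟩`. -/
def pairing {n : ℕ} (x : Coord n) (a b : Fin (n + 1)) : ℝ := x a - x b

/-- The weight lattice `X`: the vectors of `X_ℝ` that pair integrally with all coroots. -/
def weightLattice (n : ℕ) : AddSubgroup (Coord n) where
  carrier := {x | ∑ a, x a = 0 ∧ ∀ a b, ∃ m : ℤ, pairing x a b = m}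
  add_mem' := by
    rintro x y ⟨hx, hx'⟩ ⟨hy, hy'⟩
    refine ⟨by simp [Finset.sum_add_distrib, hx, hy], fun a b => ?_⟩
    obtain ⟨m, hm⟩ := hx' a b
    obtain ⟨k, hk⟩ := hy' a b
    refine ⟨m + k, ?_⟩
    simp only [pairing, Pi.add_apply] at *
    push_cast
    linarith
  zero_mem' := ⟨by simp, fun a b => ⟨0, by simp [pairing]⟩⟩
  neg_mem' := by
    rintro x ⟨hx, hx'⟩
    refine ⟨by simp [hx], fun a b => ?_⟩
    obtain ⟨m, hm⟩ := hx' a b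
    refine ⟨-m, ?_⟩
    simp only [pairing, Pi.neg_apply] at *
    push_cast
    linarith

theorem rootVec_mem (n : ℕ) (a b : Fin (n + 1)) : rootVec n a b ∈ weightLattice n := by
  refine ⟨by simp [rootVec], fun c d => ?_⟩
  refine ⟨(Pi.single a 1 - Pi.single b 1 : Fin (n + 1) → ℤ) c -
    (Pi.single a 1 - Pi.single b 1 : Fin (n + 1) → ℤ) d, ?_⟩
  simp only [pairing, rootVec, Pi.sub_apply, Pi.single_apply]
  push_cast
  rfl

/-- The root `ε_a - ε_b` as a weight. -/
def root (n : ℕ) (a b : Fin (n + 1)) : weightLattice n := ⟨rootVec n a b, rootVec_mem n a b⟩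

/-- The half-sum of the positive roots. -/
def rhoVec (n : ℕ) : Coord n :=
  (1 / 2 : ℝ) • ∑ p : Fin (n + 1) × Fin (n + 1) with p.1 < p.2, rootVec n p.1 p.2

theorem rhoVec_apply (n : ℕ) (a : Fin (n + 1)) : rhoVec n a = (n : ℝ) / 2 - (a : ℕ) := by
  have h1 : ∑ x : Fin (n + 1), ∑ y : Fin (n + 1),
      (if x < y then (if a = x then (1 : ℝ) else 0) else 0) = (n - a : ℕ) := by
    have : ∀ x y : Fin (n + 1), (if x < y then (if a = x then (1 : ℝ) else 0) else 0) =
        if a = x then (if x < y then 1 else 0) else 0 := by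
      intro x y; split_ifs <;> rfl
    simp_rw [this]
    rw [Finset.sum_comm]
    simp only [Finset.sum_ite_eq, Finset.mem_univ, if_true]
    rw [Finset.sum_boole]
    congr 1
    have : ({y : Fin (n + 1) | a < y} : Finset (Fin (n + 1))) = Finset.Ioi a := by
      ext; simp
    rw [this, Fin.card_Ioi]
    omega
  have h2 : ∑ x : Fin (n + 1), ∑ y : Fin (n + 1),
      (if x < y then (if a = y then (1 : ℝ) else 0) else 0) = (a : ℕ) := by
    have : ∀ x y : Fin (n + 1), (if x < y then (if a = y then (1 : ℝ) else 0) else 0) =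
        if a = y then (if x < y then 1 else 0) else 0 := by
      intro x y; split_ifs <;> rfl
    simp_rw [this]
    simp only [Finset.sum_ite_eq, Finset.mem_univ, if_true]
    rw [Finset.sum_boole]
    congr 1
    have : ({y : Fin (n + 1) | y < a} : Finset (Fin (n + 1))) = Finset.Iio a := by
      ext; simp
    rw [this, Fin.card_Iio]
  have h3 : rhoVec n a = 1 / 2 * (((n - a : ℕ) : ℝ) - (a : ℕ)) := by
    rw [← h1, ← h2]
    simp only [rhoVec, rootVec, Pi.smul_apply, Finset.sum_apply, smul_eq_mul, Finset.sum_filter]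
    rw [Fintype.sum_prod_type, ← Finset.sum_sub_distrib]
    congr 1
    refine Finset.sum_congr rfl fun x _ => ?_
    rw [← Finset.sum_sub_distrib]
    refine Finset.sum_congr rfl fun y _ => ?_
    split_ifs <;> simp_all
  rw [h3, Nat.cast_sub (by omega)]
  ring

theorem rhoVec_mem (n : ℕ) : rhoVec n ∈ weightLattice n := by
  refine ⟨?_, fun a b => ⟨(b : ℕ) - (a : ℕ), ?_⟩⟩
  · simp [rhoVec, rootVec, Finset.sum_comm (s := Finset.univ (α := Fin (n + 1))),
      ← Finset.mul_sum]
  · simp only [pairing, rhoVec_apply]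
    push_cast
    ring

/-- The half-sum of the positive roots as a weight. -/
def rho (n : ℕ) : weightLattice n := ⟨rhoVec n, rhoVec_mem n⟩

/-- The height of a vector of `X_ℝ`: the sum of its coefficients with respect to the simple roots
`α_j = ε_j - ε_{j+1}`. The coefficient at the `j`-th simple root is the sum of the first `j`
coordinates. -/
def ht {n : ℕ} (x : Coord n) : ℝ := ∑ j : Fin n, ∑ a ∈ Finset.Iic j.castSucc, x a

/-- A weight is dominant if it pairs nonnegatively with all positive coroots. -/
def IsDominant {n : ℕ} (x : weightLattice n) : Prop :=
  ∀ a b : Fin (n + 1), a < b → 0 ≤ pairing (x : Coord n) a b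

/-- The finite Weyl group: the symmetric group permuting the coordinates. -/
abbrev FiniteWeyl (n : ℕ) : Type := Equiv.Perm (Fin (n + 1))

/-- The simple reflections of the finite Weyl group. -/
def finiteSimple (n : ℕ) : Set (FiniteWeyl n) :=
  Set.range fun j : Fin n => Equiv.swap j.castSucc j.succ

/-- The action `w(ε_a) = ε_{w(a)}` of the finite Weyl group on the weight lattice. -/
def weylAct {n : ℕ} (w : FiniteWeyl n) (x : weightLattice n) : weightLattice n :=
  ⟨fun a => (x : Coord n) (w.symm a),
    by
      refine ⟨?_, fun a b => x.2.2 (w.symm a) (w.symm b)⟩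
      rw [Equiv.sum_comp w.symm (x : Coord n)]
      exact x.2.1⟩

/-- The dot action `w · x = w(x + ρ) - ρ`. -/
def dot {n : ℕ} (w : FiniteWeyl n) (x : weightLattice n) : weightLattice n :=
  weylAct w (x + rho n) - rho n

/-- A weight is regular if `⟨x + ρ, α^∨⟩ ≠ 0` for all roots `α`. -/
def IsRegular {n : ℕ} (x : weightLattice n) : Prop :=
  ∀ a b : Fin (n + 1), a ≠ b → pairing ((x + rho n : weightLattice n) : Coord n) a b ≠ 0

/-- For regular `x`, the unique `w` in the finite Weyl group such that `w · x` is dominant. -/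
def toDominant {n : ℕ} (x : weightLattice n) : FiniteWeyl n :=
  Classical.epsilon fun w => IsDominant (dot w x)

/-! ## The affine Weyl group and the spherical Hecke algebra -/

theorem rootVec_mem_real (n : ℕ) (a b : Fin (n + 1)) : rootVec n a b ∈ realWeights n :=
  (rootVec_mem n a b).1

/-- The linear form `x ↦ ⟨x, (ε_a - ε_b)^∨⟩` on `X_ℝ`. -/
def coroot (n : ℕ) (a b : Fin (n + 1)) : Module.Dual ℝ (realWeights n) where
  toFun x := pairing (x : Coord n) a b
  map_add' x y := by simp only [pairing, Submodule.coe_add, Pi.add_apply]; ring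
  map_smul' c x := by
    simp only [pairing, Submodule.coe_smul, Pi.smul_apply, smul_eq_mul, RingHom.id_apply]; ring

theorem coroot_self (n : ℕ) {a b : Fin (n + 1)} (h : a ≠ b) :
    coroot n a b ⟨rootVec n a b, rootVec_mem_real n a b⟩ = 2 := by
  simp only [coroot, LinearMap.coe_mk, AddHom.coe_mk, pairing, rootVec, Pi.sub_apply,
    Pi.single_apply, h, h.symm, if_true, if_false]
  norm_num

/-- The affine reflection `s_{α,m} : x ↦ x - (⟨x, α^∨⟩ - m) α` of `X_ℝ` for `α = ε_a - ε_b`. -/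
def affineReflection (n : ℕ) {a b : Fin (n + 1)} (h : a ≠ b) (m : ℤ) :
    realWeights n ≃ᵃ[ℝ] realWeights n :=
  (Module.reflection (coroot_self n h)).toAffineEquiv.trans
    (AffineEquiv.constVAdd ℝ (realWeights n)
      ((m : ℝ) • (⟨rootVec n a b, rootVec_mem_real n a b⟩ : realWeights n)))

theorem affineReflection_apply (n : ℕ) {a b : Fin (n + 1)} (h : a ≠ b) (m : ℤ)
    (x : realWeights n) :
    ((affineReflection n h m x : realWeights n) : Coord n) =
      (x : Coord n) - (pairing (x : Coord n) a b - m) • rootVec n a b := by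
  simp only [affineReflection, AffineEquiv.trans_apply, AffineEquiv.constVAdd_apply,
    LinearEquiv.coe_toAffineEquiv, Module.reflection_apply, vadd_eq_add, Submodule.coe_add,
    Submodule.coe_smul, Submodule.coe_sub, coroot, LinearMap.coe_mk, AddHom.coe_mk]
  module

theorem pairing_rootVec (n : ℕ) {a b : Fin (n + 1)} (h : a ≠ b) :
    pairing (rootVec n a b) a b = 2 := coroot_self n h

theorem affineReflection_mul_self (n : ℕ) {a b : Fin (n + 1)} (h : a ≠ b) (m : ℤ) :
    affineReflection n h m * affineReflection n h m = 1 := by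
  ext x : 2
  have hp : pairing ((x : Coord n) - (pairing (x : Coord n) a b - m) • rootVec n a b) a b =
      2 * m - pairing (x : Coord n) a b := by
    have h2 := pairing_rootVec n h
    simp only [pairing, Pi.sub_apply, Pi.smul_apply, smul_eq_mul] at *
    linear_combination (-(x : Coord n) a + (x : Coord n) b + m) * h2
  rw [AffineEquiv.mul_def, AffineEquiv.trans_apply, affineReflection_apply,
    affineReflection_apply, hp]
  change _ = (x : Coord n)
  module

/-- The simple affine reflections: `s_{α,0}` for the simple roots `α`, and `s_{β,-1}` for the
highest root `β`. -/
def affineSimple (n : ℕ) : Set (realWeights n ≃ᵃ[ℝ] realWeights n) :=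
  {r | (∃ j : Fin n, r = affineReflection n (Fin.castSucc_lt_succ (i := j)).ne 0) ∨
    ∃ h : (0 : Fin (n + 1)) ≠ Fin.last n, r = affineReflection n h (-1)}

/-- The affine Weyl group, generated by the simple affine reflections. -/
abbrev AffineWeyl (n : ℕ) : Type := Subgroup.closure (affineSimple n)

/-- The simple reflections as elements of the affine Weyl group. -/
def affineGens (n : ℕ) : Set (AffineWeyl n) := Subtype.val ⁻¹' affineSimple n

theorem affineGens_generate (n : ℕ) : GeneratedByInvolutions (affineGens n) := by
  have hsq : ∀ s ∈ affineGens n, s * s = 1 := by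
    rintro ⟨s, hs⟩ hm
    apply Subtype.ext
    change s * s = 1
    rcases hm with ⟨j, rfl⟩ | ⟨h, rfl⟩ <;> exact affineReflection_mul_self n _ _
  refine ⟨hsq, ?_⟩
  have h : (Subgroup.closure (affineGens n)).toSubmonoid = ⊤ := by
    rw [affineGens, Subgroup.closure_closure_coe_preimage]
    rfl
  rw [Subgroup.closure_toSubmonoid] at h
  have hinv : (affineGens n)⁻¹ ⊆ affineGens n := by
    intro s hs
    have h1 := hsq _ hs
    rw [← inv_inv s, inv_eq_of_mul_eq_one_left h1]
    exact hs
  rwa [Set.union_eq_left.2 hinv] at h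

/-- The fundamental alcove `C_0 = {x | -1 < ⟨x, α^∨⟩ < 0 for all positive roots α}`. -/
def fundamentalAlcove (n : ℕ) : Set (realWeights n) :=
  {x | ∀ a b : Fin (n + 1), a < b →
    -1 < pairing (x : Coord n) a b ∧ pairing (x : Coord n) a b < 0}

/-- The alcove `w_0(C_0) + x`. The longest element `w_0` of the finite Weyl group reverses the
order of the coordinates. -/
def translatedAlcove {n : ℕ} (x : weightLattice n) : Set (realWeights n) :=
  {y | ∃ c ∈ fundamentalAlcove n,
    (y : Coord n) = (fun a => (c : Coord n) (Fin.rev a)) + (x : Coord n)}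

/-- `θ(x)`, the unique element of the affine Weyl group with `θ(x)(C_0) = w_0(C_0) + x`. -/
def theta {n : ℕ} (x : weightLattice n) : AffineWeyl n :=
  Classical.epsilon fun w =>
    (w : realWeights n ≃ᵃ[ℝ] realWeights n) '' fundamentalAlcove n = translatedAlcove x

/-- The Hecke algebra of the affine Weyl group of type `A_n`. -/
abbrev AffineHecke (n : ℕ) : Type := HeckeAlgebra (affineGens n)

/-- The root lattice inside the weight lattice. -/
def rootLattice (n : ℕ) : AddSubgroup (weightLattice n) :=
  AddSubgroup.closure {x | ∃ a b : Fin (n + 1), a ≠ b ∧ x = root n a b}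

/-- The direct sum `⊕_{σ ∈ Ω}` of copies of the affine Hecke algebra, where `Ω = X / ℤΦ`. The
spherical Hecke algebra is its submodule `⊕_σ (H_f ℋ ∩ ℋ σ(H_f))`, where `H_f` denotes the
Kazhdan--Lusztig element of `w_0`. -/
abbrev GradedHecke (n : ℕ) : Type := (weightLattice n ⧸ rootLattice n) →₀ AffineHecke n

/-- The Kazhdan--Lusztig basis element of the dominant weight `x`: the Kazhdan--Lusztig element of
`θ(x)`, in the summand indexed by the class of `x`. -/
def klWeight {n : ℕ} (x : weightLattice n) : GradedHecke n :=
  Finsupp.single (QuotientAddGroup.mk x) (klH (affineGens_generate n) (theta x))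

open Classical in
/-- The extension of the Kazhdan--Lusztig basis to all weights: `(-1)^{ℓ(w_x)}` times the element
of `w_x · x` if `x` is regular, and zero if `x` is singular. -/
def klTilde {n : ℕ} (x : weightLattice n) : GradedHecke n :=
  if IsRegular x then
    (-1 : Scalars) ^ wordLength (finiteSimple n) (toDominant x) •
      klWeight (dot (toDominant x) x)
  else 0

/-! ## The pre-canonical bases -/

open Classical in
/-- The positive roots of height at least `i`, the pair `(a, b)` standing for `ε_a - ε_b`. -/
def posRootsGE (n i : ℕ) : Finset (Fin (n + 1) × Fin (n + 1)) :=
  {p | p.1 < p.2 ∧ (i : ℝ) ≤ ht (rootVec n p.1 p.2)}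

/-- The element `N^i_x` of the `i`-th pre-canonical basis, for `i ≥ 2` and dominant `x`. -/
def preCanonical {n : ℕ} (i : ℕ) (x : weightLattice n) : GradedHecke n :=
  ∑ I ∈ (posRootsGE n i).powerset,
    (-q) ^ I.card • klTilde (x - ∑ p ∈ I, root n p.1 p.2)

/-- The relation `y ≤_i x`: `x - y` is a nonnegative integral combination of positive roots of
height exactly `i`. -/
def HeightLE {n : ℕ} (i : ℕ) (y x : weightLattice n) : Prop :=
  x - y ∈ AddSubmonoid.closure
    {z | ∃ a b : Fin (n + 1), a < b ∧ ht (rootVec n a b) = i ∧ z = root n a b}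

end PreCanonical

end

/-!
The only property of the elements `klTilde x` that matters is that they are alternating for the
dot action: they change sign under a transposition, and they vanish at singular weights
(`isDotAlternating_klTilde`). The Hecke algebra plays no further role.

Write `n = k + i`. There are `k + 1` roots of height `i`, namely `γ_j = ε_j - ε_{j+i}` for
`0 ≤ j ≤ k`, with coordinates numbered from `0`. As `i ≥ n/2 + 1`, they involve a first and a last
block of `k + 1` coordinates, and at least one coordinate lies in between. So the weights `μ` below
`λ` are the `λ - ∑_j c_j γ_j` with `c_j ∈ ℕ`, and `μ` is dominant exactly when `c` satisfies
inequalities of the form `c_0 ≤ A`, `c_k ≤ B`, `c_{j+1} ≤ c_j + R_j`, `c_j ≤ c_{j+1} + L_j`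
(`HasGaps.isDominant_shift_iff`).

Put `m(d) = q^{∑ d_j} N^{i+1}_{λ - ∑ d_j γ_j}`, where `N^{i+1}` is given by its defining formula at
all weights. Adjoining the roots `γ_j` to those of height at least `i + 1` turns
`q^{∑ c_j} N^i_{λ - ∑ c_j γ_j}` into the iterated difference of `m` at `c`
(`smul_rootSum_union`), so that the claim is that the iterated differences of `m` over all
admissible `c` add up to `m(0)`.

Just outside the admissible region the weight `λ - ∑ d_j γ_j` lies on the reflection hyperplane of
a simple reflection `s`. For the two end walls the roots of height at least `i + 1` are stable under
`s`, and `m(d) = 0`. For the other walls they are stable except for one root `p` of height `i + 1`,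
while `s(p)` is one of the `γ_t`; this gives `m(d) = m(d + e_t)`
(`IsDotAlternating.rootSum_eq_smul`, `HasGaps.isWallCompatible`).

With these relations the sum telescopes one coordinate at a time (`sum_iteratedDiff`). For fixed
`c_1, …, c_k`, summing over `c_0` leaves the difference of two end terms. The upper one vanishes,
and the lower one is the iterated difference of `d ↦ m(max(0, d_1 - R_0), d)`, a function of one
coordinate less that satisfies the same relations with `A + R_0` in place of `A`.
-/

namespace PreCanonical

/-! ### The dot action and the alternating property -/

section

variable {n : ℕ}

theorem weylAct_apply (w : FiniteWeyl n) (x : weightLattice n) (a : Fin (n + 1)) :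
    (weylAct w x : Coord n) a = (x : Coord n) (w.symm a) := rfl

theorem weylAct_add (w : FiniteWeyl n) (x y : weightLattice n) :
    weylAct w (x + y) = weylAct w x + weylAct w y := rfl

theorem weylAct_sub (w : FiniteWeyl n) (x y : weightLattice n) :
    weylAct w (x - y) = weylAct w x - weylAct w y := rfl

theorem weylAct_mul (w u : FiniteWeyl n) (x : weightLattice n) :
    weylAct w (weylAct u x) = weylAct (w * u) x := rfl

theorem weylAct_sum {ι : Type*} (w : FiniteWeyl n) (s : Finset ι) (f : ι → weightLattice n) :
    weylAct w (∑ j ∈ s, f j) = ∑ j ∈ s, weylAct w (f j) :=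
  map_sum (AddMonoidHom.mk' (weylAct w) (weylAct_add w)) f s

theorem root_apply (a b c : Fin (n + 1)) :
    (root n a b : Coord n) c = (if c = a then 1 else 0) - (if c = b then 1 else 0) := by
  simp [root, rootVec, Pi.single_apply]

theorem weylAct_root (w : FiniteWeyl n) (a b : Fin (n + 1)) :
    weylAct w (root n a b) = root n (w a) (w b) := by
  ext c
  simp only [weylAct_apply, root_apply, Equiv.symm_apply_eq]

theorem dot_add_rho (w : FiniteWeyl n) (x : weightLattice n) :
    dot w x + rho n = weylAct w (x + rho n) := by
  simp [dot]

theorem dot_mul (w u : FiniteWeyl n) (x : weightLattice n) :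
    dot w (dot u x) = dot (w * u) x := by
  rw [dot, dot_add_rho, weylAct_mul, dot]

theorem dot_sub (w : FiniteWeyl n) (x y : weightLattice n) :
    dot w (x - y) = dot w x - weylAct w y := by
  rw [dot, dot, sub_add_eq_add_sub, weylAct_sub]
  abel

theorem add_rho_apply (x : weightLattice n) (a : Fin (n + 1)) :
    ((x + rho n : weightLattice n) : Coord n) a = (x : Coord n) a + (n / 2 - (a : ℕ)) := by
  rw [← rhoVec_apply]
  rfl

theorem isDominant_iff_succ_le {x : weightLattice n} :
    IsDominant x ↔ ∀ j : Fin n, (x : Coord n) j.succ ≤ (x : Coord n) j.castSucc := by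
  rw [← Fin.antitone_iff_succ_le]
  constructor
  · intro h a b hab
    rcases hab.eq_or_lt with rfl | hab
    · exact le_rfl
    · exact sub_nonneg.1 (h a b hab)
  · exact fun h a b hab => sub_nonneg.2 (h hab.le)

/-- Integrality of the pairings is what makes a strictly decreasing vector `x + ρ` come from a
dominant weight `x`. -/
theorem isDominant_iff_strictAnti {x : weightLattice n} :
    IsDominant x ↔ StrictAnti ((x + rho n : weightLattice n) : Coord n) := by
  rw [isDominant_iff_succ_le, Fin.strictAnti_iff_succ_lt]
  refine forall_congr' fun j => ?_
  obtain ⟨m, hm⟩ := x.2.2 j.castSucc j.succ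
  simp only [pairing] at hm
  rw [add_rho_apply, add_rho_apply, Fin.val_succ, Fin.val_castSucc]
  push_cast
  constructor <;> intro h
  · linarith
  · have h1 : (-1 : ℝ) < m := by linarith
    have h2 : (-1 : ℤ) < m := by exact_mod_cast h1
    have h3 : (0 : ℝ) ≤ m := by exact_mod_cast (show (0 : ℤ) ≤ m by omega)
    linarith

theorem isRegular_iff_injective {x : weightLattice n} :
    IsRegular x ↔ Function.Injective ((x + rho n : weightLattice n) : Coord n) := by
  constructor
  · intro h a b hab
    by_contra hne
    exact h a b hne (sub_eq_zero.2 hab)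
  · intro h a b hne hab
    exact hne (h (sub_eq_zero.1 hab))

theorem isRegular_dot_iff (w : FiniteWeyl n) {x : weightLattice n} :
    IsRegular (dot w x) ↔ IsRegular x := by
  rw [isRegular_iff_injective, isRegular_iff_injective, dot_add_rho]
  exact w.symm.injective_comp ((x + rho n : weightLattice n) : Coord n)

theorem exists_isDominant_dot {x : weightLattice n} (hx : IsRegular x) :
    ∃ w : FiniteWeyl n, IsDominant (dot w x) := by
  set f := ((x + rho n : weightLattice n) : Coord n) with hf
  refine ⟨(Tuple.sort fun a => -f a).symm, ?_⟩
  rw [isDominant_iff_strictAnti, dot_add_rho]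
  have hanti : Antitone fun a => f (Tuple.sort (fun a => -f a) a) := fun a b hab =>
    neg_le_neg_iff.1 (Tuple.monotone_sort (fun a => -f a) hab)
  exact hanti.strictAnti_of_injective
    ((isRegular_iff_injective.1 hx).comp (Equiv.injective _))

theorem isDominant_dot_unique {x : weightLattice n} (hx : IsRegular x) {w u : FiniteWeyl n}
    (hw : IsDominant (dot w x)) (hu : IsDominant (dot u x)) : w = u := by
  rw [isDominant_iff_strictAnti, dot_add_rho] at hw hu
  have h := Tuple.unique_antitone (f := ((x + rho n : weightLattice n) : Coord n))
    (σ := w.symm) (τ := u.symm) hw.antitone hu.antitone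
  have h' : w.symm = u.symm := Equiv.ext fun a => isRegular_iff_injective.1 hx (congrFun h a)
  simpa using congrArg Equiv.symm h'

theorem isDominant_dot_toDominant {x : weightLattice n} (hx : IsRegular x) :
    IsDominant (dot (toDominant x) x) :=
  Classical.epsilon_spec (exists_isDominant_dot hx)

theorem toDominant_dot {x : weightLattice n} (hx : IsRegular x) (u : FiniteWeyl n) :
    toDominant (dot u x) = toDominant x * u⁻¹ := by
  have hux := (isRegular_dot_iff u).2 hx
  refine isDominant_dot_unique hux (isDominant_dot_toDominant hux) ?_
  rw [dot_mul, inv_mul_cancel_right]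
  exact isDominant_dot_toDominant hx

theorem generatedByInvolutions_finiteSimple (n : ℕ) :
    GeneratedByInvolutions (finiteSimple n) where
  sq := by
    rintro _ ⟨j, rfl⟩
    exact Equiv.swap_mul_self _ _
  gen := Equiv.Perm.mclosure_swap_castSucc_succ n

/-- A reduced word for `w` is a product of transpositions, each of sign `-1`. -/
theorem neg_one_pow_wordLength (w : FiniteWeyl n) :
    (-1 : ℤˣ) ^ wordLength (finiteSimple n) w = Equiv.Perm.sign w := by
  obtain ⟨l, hl, rfl, hlen⟩ := exists_word (generatedByInvolutions_finiteSimple n) w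
  rw [← hlen]
  clear hlen
  induction l with
  | nil => simp
  | cons s t ih =>
    obtain ⟨j, rfl⟩ := hl s (by simp)
    rw [List.length_cons, pow_succ', ih fun r hr => hl r (by simp [hr]), List.prod_cons, map_mul,
      Equiv.Perm.sign_swap (Fin.castSucc_lt_succ (i := j)).ne]

/-- A function on the weight lattice is alternating for the dot action if it changes sign under
the transpositions and vanishes at the weights that one of them fixes. The second condition does
not follow from the first when the target has `2`-torsion. -/
structure IsDotAlternating {M : Type*} [AddCommGroup M] (T : weightLattice n → M) : Prop where
  swap : ∀ a b, a ≠ b → ∀ x, T (dot (Equiv.swap a b) x) = -T x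
  singular : ∀ a b, a ≠ b → ∀ x : weightLattice n,
    ((x + rho n : weightLattice n) : Coord n) a = ((x + rho n : weightLattice n) : Coord n) b →
      T x = 0

theorem isDotAlternating_klTilde (n : ℕ) : IsDotAlternating (klTilde (n := n)) where
  swap a b hab x := by
    by_cases hx : IsRegular x
    · rw [klTilde, klTilde, if_pos hx, if_pos ((isRegular_dot_iff _).2 hx), toDominant_dot hx,
        dot_mul, inv_mul_cancel_right, ← neg_smul]
      congr 1
      have h := congrArg (fun e : ℤˣ => ((e : ℤ) : Scalars))
        (neg_one_pow_wordLength (toDominant x * (Equiv.swap a b)⁻¹))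
      have h' := congrArg (fun e : ℤˣ => ((e : ℤ) : Scalars))
        (neg_one_pow_wordLength (toDominant x))
      simp only [map_mul, map_inv, Equiv.Perm.sign_swap hab] at h
      push_cast at h h'
      rw [h, h']
      simp
    · rw [klTilde, klTilde, if_neg hx, if_neg (mt (isRegular_dot_iff _).1 hx), neg_zero]
  singular a b hab x hx := by
    rw [klTilde, if_neg]
    exact fun h => h a b hab (sub_eq_zero.2 hx)

end

/-! ### Sums of iterated differences over a region with walls -/

/-- The iterated difference `∏_j (1 - E_j)` of a function of `k` natural numbers, where `E_j`
raises the `j`-th argument by one. -/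
def iteratedDiff {M : Type*} [AddCommGroup M] : (k : ℕ) → ((Fin k → ℕ) → M) → (Fin k → ℕ) → M
  | 0, m, c => m c
  | k + 1, m, c => iteratedDiff k (fun d => m (Fin.cons (c 0) d)) (Fin.tail c) -
      iteratedDiff k (fun d => m (Fin.cons (c 0 + 1) d)) (Fin.tail c)

section

variable {M : Type*} [AddCommGroup M]

theorem iteratedDiff_zero (k : ℕ) (c : Fin k → ℕ) : iteratedDiff k (fun _ => (0 : M)) c = 0 := by
  induction k with
  | zero => rfl
  | succ k ih => rw [iteratedDiff, ih, sub_zero]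

theorem iteratedDiff_cons (k : ℕ) (m : (Fin (k + 1) → ℕ) → M) (x : ℕ) (c : Fin k → ℕ) :
    iteratedDiff (k + 1) m (Fin.cons x c : Fin (k + 1) → ℕ) =
      iteratedDiff k (fun d => m (Fin.cons x d)) c -
        iteratedDiff k (fun d => m (Fin.cons (x + 1) d)) c := by
  rw [iteratedDiff, Fin.cons_zero, Fin.tail_cons]

theorem iteratedDiff_smul {R : Type*} [Ring R] [Module R M] (k : ℕ) (r : R)
    (m : (Fin k → ℕ) → M) (c : Fin k → ℕ) :
    iteratedDiff k (fun d => r • m d) c = r • iteratedDiff k m c := by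
  induction k with
  | zero => rfl
  | succ k ih => rw [iteratedDiff, iteratedDiff, ih, ih, smul_sub]

end

/-- The vectors `c` whose ends are bounded by `A` and `B` and whose increments and decrements are
bounded by `R` and `L`. -/
def IsAdmissible {k : ℕ} (A B : ℕ) (L R : Fin k → ℕ) (c : Fin (k + 1) → ℕ) : Prop :=
  c 0 ≤ A ∧ c (Fin.last k) ≤ B ∧
    ∀ j : Fin k, c j.succ ≤ c j.castSucc + R j ∧ c j.castSucc ≤ c j.succ + L j

theorem finite_isAdmissible {k : ℕ} (A B : ℕ) (L R : Fin k → ℕ) :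
    {c | IsAdmissible A B L R c}.Finite := by
  refine (Set.finite_Iic fun j : Fin (k + 1) => A + j * ∑ t, R t).subset fun c hc j => ?_
  induction j using Fin.induction with
  | zero => simpa using hc.1
  | succ j ih =>
    have h1 := (hc.2.2 j).1
    have h2 : R j ≤ ∑ t, R t := Finset.single_le_sum (fun t _ => Nat.zero_le _) (Finset.mem_univ j)
    simp only [Fin.val_castSucc, Fin.val_succ] at ih ⊢
    linarith

theorem isAdmissible_cons {k : ℕ} (A B : ℕ) (L R : Fin (k + 1) → ℕ) (x : ℕ)
    (c : Fin (k + 1) → ℕ) :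
    IsAdmissible A B L R (Fin.cons x c : Fin (k + 2) → ℕ) ↔
      IsAdmissible (A + R 0) B (Fin.tail L) (Fin.tail R) c ∧
        x ∈ Finset.Icc (c 0 - R 0) (min A (c 0 + L 0)) := by
  simp only [IsAdmissible, Fin.forall_fin_succ (n := k), Fin.cons_zero, ← Fin.succ_last,
    Fin.cons_succ, Fin.castSucc_zero, ← Fin.succ_castSucc, Fin.tail, Finset.mem_Icc]
  constructor
  · rintro ⟨h1, h2, ⟨h3, h4⟩, h5⟩
    exact ⟨⟨by omega, h2, h5⟩, by omega, by omega⟩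
  · rintro ⟨⟨h1, h2, h5⟩, h3, h4⟩
    exact ⟨by omega, h2, ⟨by omega, by omega⟩, h5⟩

open Function in
/-- The conditions on `m` say that it vanishes just beyond the walls `c 0 ≤ A` and
`c (last) ≤ B`, and that just beyond each of the other walls it is constant in the direction
that leads back to the wall. -/
structure IsWallCompatible {M : Type*} [AddCommGroup M] {k : ℕ} (A B : ℕ) (L R : Fin k → ℕ)
    (m : (Fin (k + 1) → ℕ) → M) : Prop where
  first : ∀ d, d 0 = A + 1 → m d = 0
  last : ∀ d, d (Fin.last k) = B + 1 → m d = 0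
  right : ∀ (j : Fin k) (d), d j.succ = d j.castSucc + R j + 1 →
    m d = m (update d j.castSucc (d j.castSucc + 1))
  left : ∀ (j : Fin k) (d), d j.castSucc = d j.succ + L j + 1 →
    m d = m (update d j.succ (d j.succ + 1))

section

variable {M : Type*} [AddCommGroup M] {k : ℕ} {A B : ℕ}

theorem IsWallCompatible.right_zero {L R : Fin (k + 1) → ℕ} {m : (Fin (k + 2) → ℕ) → M}
    (h : IsWallCompatible A B L R m) (x : ℕ) (c : Fin (k + 1) → ℕ) (hc : c 0 = x + R 0 + 1) :
    m (Fin.cons x c) = m (Fin.cons (x + 1) c) := by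
  have := h.right 0 (Fin.cons x c : Fin (k + 2) → ℕ) (by simpa using hc)
  rw [this, Fin.castSucc_zero, Fin.cons_zero, Fin.update_cons_zero]

theorem IsWallCompatible.left_zero {L R : Fin (k + 1) → ℕ} {m : (Fin (k + 2) → ℕ) → M}
    (h : IsWallCompatible A B L R m) (x : ℕ) (c : Fin (k + 1) → ℕ) (hc : x = c 0 + L 0 + 1) :
    m (Fin.cons x c) = m (Fin.cons x (Function.update c 0 (c 0 + 1))) := by
  have := h.left 0 (Fin.cons x c : Fin (k + 2) → ℕ) (by simpa using hc)
  rw [this, Fin.cons_succ, Fin.cons_update]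

/-- Restricting `m` to the least admissible value of the first coordinate. -/
theorem IsWallCompatible.restrict {L R : Fin (k + 1) → ℕ} {m : (Fin (k + 2) → ℕ) → M}
    (h : IsWallCompatible A B L R m) :
    IsWallCompatible (A + R 0) B (Fin.tail L) (Fin.tail R)
      (fun d : Fin (k + 1) → ℕ => m (Fin.cons (d 0 - R 0) d)) where
  first d hd := h.first _ (by rw [Fin.cons_zero]; omega)
  last d hd := h.last _ (by rwa [← Fin.succ_last, Fin.cons_succ])
  right j d hd := by
    have h1 := h.right j.succ (Fin.cons (d 0 - R 0) d : Fin (k + 2) → ℕ)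
      (by simpa [← Fin.succ_castSucc, Fin.tail] using hd)
    rw [← Fin.succ_castSucc, Fin.cons_succ, ← Fin.cons_update] at h1
    rw [h1]
    rcases Nat.eq_zero_or_pos j.val with hj | hj
    · -- The first coordinate of `d` changes, and with it its least admissible predecessor,
      -- unless truncated subtraction keeps the latter at zero.
      have hj0 : j.castSucc = 0 := Fin.ext hj
      rw [hj0, Function.update_self]
      rcases lt_or_ge (d 0) (R 0) with hlt | hge
      · rw [show d 0 + 1 - R 0 = d 0 - R 0 by omega]
      · rw [h.right_zero _ _ (by rw [Function.update_self]; omega),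
          show d 0 - R 0 + 1 = d 0 + 1 - R 0 by omega]
    · have hj0 : (0 : Fin (k + 1)) ≠ j.castSucc := fun e => by
        have := congrArg Fin.val e
        simp at this
        omega
      rw [Function.update_of_ne hj0]
  left j d hd := by
    have h1 := h.left j.succ (Fin.cons (d 0 - R 0) d : Fin (k + 2) → ℕ)
      (by simpa [← Fin.succ_castSucc, Fin.tail] using hd)
    rw [Fin.cons_succ, ← Fin.cons_update] at h1
    rw [h1, Function.update_of_ne (Fin.succ_ne_zero j).symm]

/-- Letting the first argument vary with the second does not change the difference in the second,
because `m` is constant in its first argument just beyond the wall bounding `c 0` from below. -/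
theorem iteratedDiff_restrict {L R : Fin (k + 1) → ℕ} {m : (Fin (k + 2) → ℕ) → M}
    (h : IsWallCompatible A B L R m) (c : Fin (k + 1) → ℕ) :
    iteratedDiff (k + 1) (fun d => m (Fin.cons (c 0 - R 0) d)) c =
      iteratedDiff (k + 1) (fun d : Fin (k + 1) → ℕ => m (Fin.cons (d 0 - R 0) d)) c := by
  simp only [iteratedDiff, Fin.cons_zero]
  congr 2
  funext d
  rcases lt_or_ge (c 0) (R 0) with hlt | hge
  · rw [show c 0 + 1 - R 0 = c 0 - R 0 by omega]
  · rw [h.right_zero _ _ (by rw [Fin.cons_zero]; omega),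
      show c 0 - R 0 + 1 = c 0 + 1 - R 0 by omega]

/-- The upper end of the telescoping sum vanishes, whichever of the two upper walls comes first. -/
theorem iteratedDiff_beyond {L R : Fin (k + 1) → ℕ} {m : (Fin (k + 2) → ℕ) → M}
    (h : IsWallCompatible A B L R m) (c : Fin (k + 1) → ℕ) :
    iteratedDiff (k + 1) (fun d => m (Fin.cons (min A (c 0 + L 0) + 1) d)) c = 0 := by
  rcases le_total A (c 0 + L 0) with hle | hle
  · rw [min_eq_left hle]
    have : (fun d : Fin (k + 1) → ℕ => m (Fin.cons (A + 1) d)) = fun _ => 0 :=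
      funext fun d => h.first _ (Fin.cons_zero _ _)
    rw [this, iteratedDiff_zero]
  · rw [min_eq_right hle, iteratedDiff, sub_eq_zero]
    congr 1
    funext d
    rw [h.left_zero _ _ (by rw [Fin.cons_zero]), Fin.cons_zero, Fin.update_cons_zero]

/-- Summing out the first coordinate telescopes; the upper end contributes nothing, and the lower
end is the same sum with one coordinate less. -/
theorem sum_iteratedDiff {k : ℕ} {A B : ℕ} {L R : Fin k → ℕ} {m : (Fin (k + 1) → ℕ) → M}
    (h : IsWallCompatible A B L R m) (C : Finset (Fin (k + 1) → ℕ))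
    (hC : ∀ c, c ∈ C ↔ IsAdmissible A B L R c) :
    ∑ c ∈ C, iteratedDiff (k + 1) m c = m 0 := by
  have telescope : ∀ (f : ℕ → M) (a b : ℕ), a ≤ b →
      ∑ x ∈ Finset.Icc a b, (f x - f (x + 1)) = f a - f (b + 1) := by
    intro f a b hab
    have h := Finset.sum_Ico_sub f (show a ≤ b + 1 by omega)
    rw [Finset.Ico_add_one_right_eq_Icc] at h
    rw [← neg_sub (f (b + 1)), ← h, ← Finset.sum_neg_distrib]
    simp
  induction k generalizing A B with
  | zero =>
    have hsum : ∑ c ∈ C, iteratedDiff 1 m c =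
        ∑ x ∈ Finset.Icc 0 (min A B), (m (fun _ => x) - m (fun _ => x + 1)) := by
      refine Finset.sum_bij' (fun c _ => c 0) (fun x _ _ => x) ?_ ?_ ?_ ?_ ?_
      · intro c hc
        have := (hC c).1 hc
        exact Finset.mem_Icc.2 ⟨Nat.zero_le _, le_min this.1 this.2.1⟩
      · intro x hx
        rw [Finset.mem_Icc, le_min_iff] at hx
        exact (hC _).2 ⟨hx.2.1, hx.2.2, fun j => j.elim0⟩
      · intro c _
        funext j
        rw [Fin.fin_one_eq_zero j]
      · intro x _
        rfl
      · intro c _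
        simp only [iteratedDiff]
        congr 2 <;>
        · funext j
          rw [Fin.fin_one_eq_zero j, Fin.cons_zero]
    rw [hsum, telescope _ _ _ (Nat.zero_le _)]
    have hz : m (fun _ => min A B + 1) = 0 := by
      rcases le_total A B with hle | hle
      · exact h.first _ (by rw [min_eq_left hle])
      · exact h.last _ (by rw [min_eq_right hle])
    rw [hz, sub_zero]
    rfl
  | succ k ih =>
    classical
    have hC' : ∀ c, c ∈ C.image Fin.tail ↔
        IsAdmissible (A + R 0) B (Fin.tail L) (Fin.tail R) c := by
      intro c
      rw [Finset.mem_image]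
      constructor
      · rintro ⟨e, he, rfl⟩
        rw [hC, ← Fin.cons_self_tail e, isAdmissible_cons] at he
        exact he.1
      · intro hc
        refine ⟨Fin.cons (c 0 - R 0) c, ?_, Fin.tail_cons _ _⟩
        rw [hC, isAdmissible_cons]
        have := hc.1
        exact ⟨hc, Finset.mem_Icc.2 ⟨le_rfl, by omega⟩⟩
    have hsum : ∑ e ∈ C, iteratedDiff (k + 2) m e = ∑ c ∈ C.image Fin.tail,
        ∑ x ∈ Finset.Icc (c 0 - R 0) (min A (c 0 + L 0)),
          iteratedDiff (k + 2) m (Fin.cons x c : Fin (k + 2) → ℕ) := by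
      rw [Finset.sum_sigma']
      refine Finset.sum_bij' (fun e _ => ⟨Fin.tail e, e 0⟩) (fun p _ => Fin.cons p.2 p.1)
        ?_ ?_ ?_ ?_ ?_
      · intro e he
        rw [hC, ← Fin.cons_self_tail e, isAdmissible_cons] at he
        exact Finset.mem_sigma.2 ⟨(hC' _).2 he.1, he.2⟩
      · rintro ⟨c, x⟩ hp
        rw [Finset.mem_sigma, hC'] at hp
        exact (hC _).2 ((isAdmissible_cons ..).2 hp)
      · intro e _
        exact Fin.cons_self_tail e
      · rintro ⟨c, x⟩ _
        rfl
      · intro e _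
        rw [Fin.cons_self_tail]
    have hzero : (Fin.cons ((0 : Fin (k + 1) → ℕ) 0 - R 0) 0 : Fin (k + 2) → ℕ) = 0 :=
      funext fun j => by refine Fin.cases ?_ (fun _ => ?_) j <;> simp
    rw [hsum, ← hzero]
    refine Eq.trans ?_ (ih h.restrict (C.image Fin.tail) hC')
    refine Finset.sum_congr rfl fun c hc => ?_
    have hle : c 0 - R 0 ≤ min A (c 0 + L 0) := by
      have := ((hC' c).1 hc).1
      omega
    simp only [iteratedDiff_cons (k + 1)]
    rw [telescope (fun x => iteratedDiff (k + 1) (fun d => m (Fin.cons x d)) c) _ _ hle,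
      iteratedDiff_beyond h, sub_zero, iteratedDiff_restrict h]

end

/-! ### Sums over sets of roots -/

section

variable {n : ℕ} {M : Type*} [AddCommGroup M] [Module Scalars M]

/-- The value of `T` at `e^x ∏_{α ∈ S} (1 - q e^{-α})`, where `T` is extended linearly to formal
combinations of the exponentials `e^x`. -/
noncomputable def rootSum (T : weightLattice n → M) (S : Finset (Fin (n + 1) × Fin (n + 1)))
    (x : weightLattice n) : M :=
  ∑ I ∈ S.powerset, (-q) ^ I.card • T (x - ∑ p ∈ I, root n p.1 p.2)

theorem preCanonical_eq_rootSum (i : ℕ) (x : weightLattice n) :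
    preCanonical i x = rootSum klTilde (posRootsGE n i) x := rfl

theorem rootSum_insert (T : weightLattice n → M) {S : Finset (Fin (n + 1) × Fin (n + 1))}
    {p : Fin (n + 1) × Fin (n + 1)} (hp : p ∉ S) (x : weightLattice n) :
    rootSum T (insert p S) x = rootSum T S x - q • rootSum T S (x - root n p.1 p.2) := by
  rw [rootSum, Finset.sum_powerset_insert hp, sub_eq_add_neg, ← neg_smul, rootSum, rootSum,
    Finset.smul_sum]
  congr 1
  refine Finset.sum_congr rfl fun I hI => ?_
  have hpI : p ∉ I := fun h => hp (Finset.mem_powerset.1 hI h)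
  rw [Finset.card_insert_of_notMem hpI, Finset.sum_insert hpI, pow_succ', mul_smul,
    sub_add_eq_sub_sub]

/-- The set `S` of pairs is stable under the permutation `w`. -/
def IsStable (w : FiniteWeyl n) (S : Finset (Fin (n + 1) × Fin (n + 1))) : Prop :=
  S.map (w.prodCongr w).toEmbedding = S

theorem isStable_swap {a b : Fin (n + 1)} {S : Finset (Fin (n + 1) × Fin (n + 1))}
    (h : ∀ p ∈ S, (Equiv.swap a b p.1, Equiv.swap a b p.2) ∈ S) :
    IsStable (Equiv.swap a b) S := by
  refine Finset.eq_of_subset_of_card_le (fun p hp => ?_) (Finset.card_map _).ge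
  obtain ⟨r, hr, rfl⟩ := Finset.mem_map.1 hp
  exact h r hr

theorem IsStable.map_mem_powerset {w : FiniteWeyl n} {S I : Finset (Fin (n + 1) × Fin (n + 1))}
    (h : IsStable w S) (hI : I ∈ S.powerset) :
    I.map (w.prodCongr w).toEmbedding ∈ S.powerset := by
  rw [Finset.mem_powerset] at hI ⊢
  have := Finset.map_subset_map (f := (w.prodCongr w).toEmbedding).2 hI
  rwa [h] at this

theorem map_swap_map_swap (a b : Fin (n + 1)) (I : Finset (Fin (n + 1) × Fin (n + 1))) :
    (I.map ((Equiv.swap a b).prodCongr (Equiv.swap a b)).toEmbedding).map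
      ((Equiv.swap a b).prodCongr (Equiv.swap a b)).toEmbedding = I := by
  ext p
  simp [Prod.map_def]

theorem dot_sub_sum (w : FiniteWeyl n) (x : weightLattice n)
    (I : Finset (Fin (n + 1) × Fin (n + 1))) :
    dot w (x - ∑ p ∈ I, root n p.1 p.2) =
      dot w x - ∑ p ∈ I.map (w.prodCongr w).toEmbedding, root n p.1 p.2 := by
  rw [dot_sub, weylAct_sum, Finset.sum_map]
  simp [weylAct_root]

theorem IsDotAlternating.rootSum_swap {T : weightLattice n → M} (hT : IsDotAlternating T)
    {S : Finset (Fin (n + 1) × Fin (n + 1))} {a b : Fin (n + 1)} (hab : a ≠ b)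
    (hS : IsStable (Equiv.swap a b) S) (x : weightLattice n) :
    rootSum T S (dot (Equiv.swap a b) x) = -rootSum T S x := by
  rw [rootSum, rootSum, ← Finset.sum_neg_distrib]
  refine Finset.sum_bij' (fun I _ => I.map _) (fun I _ => I.map _)
    (fun I hI => hS.map_mem_powerset hI) (fun I hI => hS.map_mem_powerset hI)
    (fun I _ => map_swap_map_swap a b I) (fun I _ => map_swap_map_swap a b I) fun I _ => ?_
  rw [← smul_neg, ← hT.swap a b hab, dot_sub_sum, map_swap_map_swap, Finset.card_map]

theorem dot_swap_eq_self {a b : Fin (n + 1)} {x : weightLattice n}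
    (hx : ((x + rho n : weightLattice n) : Coord n) a = ((x + rho n : weightLattice n) : Coord n) b) :
    dot (Equiv.swap a b) x = x := by
  have h : weylAct (Equiv.swap a b) (x + rho n) = x + rho n := by
    ext c
    rw [weylAct_apply, Equiv.symm_swap, Equiv.swap_apply_def]
    split_ifs with h1 h2
    · rw [h1, hx]
    · rw [h2, hx]
    · rfl
  rw [dot, h, add_sub_cancel_right]

/-- The terms cancel in pairs `I`, `s(I)`; for `I = s(I)` the weight is singular. -/
theorem IsDotAlternating.rootSum_singular {T : weightLattice n → M} (hT : IsDotAlternating T)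
    {S : Finset (Fin (n + 1) × Fin (n + 1))} {a b : Fin (n + 1)} (hab : a ≠ b)
    (hS : IsStable (Equiv.swap a b) S) {x : weightLattice n}
    (hx : ((x + rho n : weightLattice n) : Coord n) a =
      ((x + rho n : weightLattice n) : Coord n) b) :
    rootSum T S x = 0 := by
  refine Finset.sum_involution (fun I _ => I.map _) ?_ ?_
    (fun I hI => hS.map_mem_powerset hI) (fun I _ => map_swap_map_swap a b I)
  · intro I _
    have h := dot_sub_sum (Equiv.swap a b) x I
    rw [dot_swap_eq_self hx] at h
    rw [← h, hT.swap a b hab, Finset.card_map, smul_neg, add_neg_cancel]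
  · intro I _ hne hI
    have h := dot_sub_sum (Equiv.swap a b) x I
    rw [dot_swap_eq_self hx, hI] at h
    refine hne ?_
    rw [hT.singular a b hab, smul_zero]
    have h' := congrArg (fun y : weightLattice n => ((y + rho n : weightLattice n) : Coord n) a) h
    simp only [dot_add_rho, weylAct_apply, Equiv.symm_swap, Equiv.swap_apply_left] at h'
    exact h'.symm

/-- If `x` lies on the reflection hyperplane of `s` and `S` is stable under `s` except for the
single root `p`, then subtracting `s(p)` from `x` multiplies the sum by `q⁻¹`. -/
theorem IsDotAlternating.rootSum_eq_smul {T : weightLattice n → M} (hT : IsDotAlternating T)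
    {S : Finset (Fin (n + 1) × Fin (n + 1))} {a b : Fin (n + 1)} (hab : a ≠ b)
    {p : Fin (n + 1) × Fin (n + 1)} (hp : p ∈ S)
    (hS : IsStable (Equiv.swap a b) (S.erase p)) {x : weightLattice n}
    (hx : ((x + rho n : weightLattice n) : Coord n) a =
      ((x + rho n : weightLattice n) : Coord n) b) :
    rootSum T S x =
      q • rootSum T S (x - root n (Equiv.swap a b p.1) (Equiv.swap a b p.2)) := by
  set s := Equiv.swap a b with hs
  have hx' : (((x - root n (s p.1) (s p.2) - root n p.1 p.2) + rho n : weightLattice n) :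
      Coord n) a =
      (((x - root n (s p.1) (s p.2) - root n p.1 p.2) + rho n : weightLattice n) :
      Coord n) b := by
    have h : ∀ c, (((x - root n (s p.1) (s p.2) - root n p.1 p.2) + rho n : weightLattice n) :
        Coord n) c = ((x + rho n : weightLattice n) : Coord n) c -
          (root n (s p.1) (s p.2) : Coord n) c - (root n p.1 p.2 : Coord n) c := by
      intro c
      simp only [AddSubgroup.coe_add, AddSubgroup.coe_sub, Pi.add_apply, Pi.sub_apply]
      ring
    have e1 : (root n (s p.1) (s p.2) : Coord n) a = (root n p.1 p.2 : Coord n) b := by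
      rw [← weylAct_root, weylAct_apply, hs, Equiv.symm_swap, Equiv.swap_apply_left]
    have e2 : (root n (s p.1) (s p.2) : Coord n) b = (root n p.1 p.2 : Coord n) a := by
      rw [← weylAct_root, weylAct_apply, hs, Equiv.symm_swap, Equiv.swap_apply_right]
    rw [h, h, hx, e1, e2]
    ring
  have hd : dot s (x - root n p.1 p.2) = x - root n (s p.1) (s p.2) := by
    rw [dot_sub, weylAct_root, dot_swap_eq_self hx]
  rw [← Finset.insert_erase hp, rootSum_insert T (Finset.notMem_erase p S),
    rootSum_insert T (Finset.notMem_erase p S), hT.rootSum_singular hab hS hx,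
    hT.rootSum_singular hab hS hx', smul_zero, sub_zero, zero_sub, ← hd,
    hT.rootSum_swap hab hS, smul_neg]

/-- Adjoining to `P` further roots `γ_j` amounts to taking iterated differences of the values of
the sum over `P` along the `γ_j`. -/
theorem smul_rootSum_union (T : weightLattice n → M) (P : Finset (Fin (n + 1) × Fin (n + 1)))
    {k : ℕ} (γ : Fin k → Fin (n + 1) × Fin (n + 1)) (hγ : Function.Injective γ)
    (hP : ∀ j, γ j ∉ P) (x : weightLattice n) (c : Fin k → ℕ) :
    q ^ (∑ j, c j) • rootSum T (P ∪ Finset.univ.image γ)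
        (x - ∑ j, c j • root n (γ j).1 (γ j).2) =
      iteratedDiff k (fun d => q ^ (∑ j, d j) •
        rootSum T P (x - ∑ j, d j • root n (γ j).1 (γ j).2)) c := by
  induction k generalizing x with
  | zero => simp [iteratedDiff]
  | succ k ih =>
    have hset : P ∪ Finset.univ.image γ =
        insert (γ 0) (P ∪ Finset.univ.image fun j => γ (Fin.succ j)) := by
      ext p
      simp only [Finset.mem_union, Finset.mem_image, Finset.mem_univ, true_and,
        Finset.mem_insert, Fin.exists_fin_succ, eq_comm (a := p)]
      tauto
    have hnot : γ 0 ∉ P ∪ Finset.univ.image fun j : Fin k => γ j.succ := by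
      simp only [Finset.mem_union, Finset.mem_image, Finset.mem_univ, true_and, not_or, not_exists]
      exact ⟨hP 0, fun j hj => Fin.succ_ne_zero j (hγ hj)⟩
    have key : ∀ y : ℕ, iteratedDiff k (fun d => q ^ (∑ j, (Fin.cons y d : Fin (k + 1) → ℕ) j) •
          rootSum T P (x - ∑ j, (Fin.cons y d : Fin (k + 1) → ℕ) j • root n (γ j).1 (γ j).2))
          (Fin.tail c) =
        q ^ y • q ^ (∑ j, Fin.tail c j) • rootSum T (P ∪ Finset.univ.image fun j => γ (Fin.succ j))
          (x - y • root n (γ 0).1 (γ 0).2 -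
            ∑ j, Fin.tail c j • root n (γ (Fin.succ j)).1 (γ (Fin.succ j)).2) := by
      intro y
      rw [ih (fun j => γ j.succ) (hγ.comp (Fin.succ_injective k)) (fun j => hP j.succ),
        ← iteratedDiff_smul]
      congr 1
      funext d
      simp only [Fin.sum_univ_succ, Fin.cons_zero, Fin.cons_succ, pow_add, mul_smul,
        sub_add_eq_sub_sub]
    rw [iteratedDiff, key, key, hset, rootSum_insert T hnot]
    simp only [Fin.sum_univ_succ, Fin.tail, smul_sub, ← mul_smul, sub_add_eq_sub_sub]
    congr 2
    · rw [pow_add]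
    · rw [pow_add, pow_succ]
      ring
    · rw [succ_nsmul]
      congr 1
      abel

end

/-! ### Roots of height `i` and the weights below a dominant weight -/

theorem ht_root {n : ℕ} (a b : Fin (n + 1)) : ht (rootVec n a b) = (b : ℝ) - (a : ℝ) := by
  have key : ∀ c : Fin (n + 1), ∑ j : Fin n, ∑ d ∈ Finset.Iic j.castSucc,
      (Pi.single c 1 : Coord n) d = n - (c : ℝ) := by
    intro c
    have h1 : ∀ j : Fin n, ∑ d ∈ Finset.Iic j.castSucc, (Pi.single c 1 : Coord n) d =
        if (c : ℕ) ≤ j then 1 else 0 := by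
      intro j
      simp only [Pi.single_apply, Finset.sum_ite_eq', Finset.mem_Iic]
      rfl
    rw [Finset.sum_congr rfl fun j _ => h1 j,
      Fin.sum_univ_eq_sum_range (fun j => if (c : ℕ) ≤ j then (1 : ℝ) else 0) n,
      Finset.sum_boole]
    have h2 : (Finset.range n).filter (fun j => (c : ℕ) ≤ j) = Finset.Ico (c : ℕ) n := by
      ext j
      simp [and_comm]
    rw [h2, Nat.card_Ico, Nat.cast_sub (by omega)]
  simp only [ht, rootVec, Pi.sub_apply, Finset.sum_sub_distrib, key]
  ring

theorem mem_posRootsGE {n i : ℕ} (hi : 0 < i) (p : Fin (n + 1) × Fin (n + 1)) :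
    p ∈ posRootsGE n i ↔ (p.1 : ℕ) + i ≤ p.2 := by
  simp only [posRootsGE, Finset.mem_filter_univ, ht_root, Fin.lt_def]
  rw [le_sub_iff_add_le']
  norm_cast
  omega

theorem sum_update_add_one_nsmul {ι N : Type*} [Fintype ι] [DecidableEq ι] [AddCommMonoid N]
    (d : ι → ℕ) (j : ι) (r : ι → N) :
    ∑ t, Function.update d j (d j + 1) t • r t = ∑ t, d t • r t + r j := by
  have h : Function.update d j (d j + 1) = d + Pi.single j 1 := by
    funext t
    by_cases ht : t = j
    · subst ht
      simp
    · simp [ht]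
  simp [h, add_nsmul, Finset.sum_add_distrib, Pi.single_apply, ite_smul]

section

variable {k i : ℕ}

/-- The roots of height `i` in type `A_{k+i}`, indexed by their first coordinate. -/
def heightRoot (k i : ℕ) (j : Fin (k + 1)) : Fin (k + i + 1) × Fin (k + i + 1) :=
  (⟨j, by omega⟩, ⟨j + i, by omega⟩)

theorem heightRoot_injective : Function.Injective (heightRoot k i) := fun j t h => by
  have := congrArg (fun p => (p.1 : ℕ)) h
  exact Fin.ext this

/-- The weight `lam - ∑_j c_j γ_j`, where `γ_j` are the roots of height `i`. -/
def shift (lam : weightLattice (k + i)) (c : Fin (k + 1) → ℕ) : weightLattice (k + i) :=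
  lam - ∑ j, c j • root (k + i) (heightRoot k i j).1 (heightRoot k i j).2

theorem shift_zero (lam : weightLattice (k + i)) : shift lam 0 = lam := by
  simp [shift]

theorem shift_update (lam : weightLattice (k + i)) (d : Fin (k + 1) → ℕ) (j : Fin (k + 1)) :
    shift lam (Function.update d j (d j + 1)) =
      shift lam d - root (k + i) (heightRoot k i j).1 (heightRoot k i j).2 := by
  rw [shift, sum_update_add_one_nsmul, sub_add_eq_sub_sub, shift]

theorem shift_apply (lam : weightLattice (k + i)) (c : Fin (k + 1) → ℕ) (a : Fin (k + i + 1)) :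
    (shift lam c : Coord (k + i)) a = (lam : Coord (k + i)) a -
      ∑ j : Fin (k + 1), (c j : ℝ) *
        ((if (a : ℕ) = j then 1 else 0) - (if (a : ℕ) = j + i then 1 else 0)) := by
  simp [shift, root_apply, heightRoot, Fin.ext_iff]

end

theorem shift_apply_left {k i : ℕ} (hki : k < i) (lam : weightLattice (k + i))
    (c : Fin (k + 1) → ℕ) (j : Fin (k + 1)) (a : Fin (k + i + 1)) (ha : (a : ℕ) = j) :
    (shift lam c : Coord (k + i)) a = (lam : Coord (k + i)) a - c j := by
  rw [shift_apply, Finset.sum_eq_single j]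
  · rw [if_pos ha, if_neg (by omega)]
    ring
  · intro t _ ht
    have : (t : ℕ) ≠ j := fun h => ht (Fin.ext h)
    rw [if_neg (by omega), if_neg (by omega)]
    ring
  · simp

theorem shift_apply_right {k i : ℕ} (hki : k < i) (lam : weightLattice (k + i))
    (c : Fin (k + 1) → ℕ) (j : Fin (k + 1)) (a : Fin (k + i + 1)) (ha : (a : ℕ) = j + i) :
    (shift lam c : Coord (k + i)) a = (lam : Coord (k + i)) a + c j := by
  rw [shift_apply, Finset.sum_eq_single j]
  · rw [if_pos ha, if_neg (by omega)]
    ring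
  · intro t _ ht
    have : (t : ℕ) ≠ j := fun h => ht (Fin.ext h)
    rw [if_neg (by omega), if_neg (by omega)]
    ring
  · simp

theorem shift_apply_middle {k i : ℕ} (lam : weightLattice (k + i))
    (c : Fin (k + 1) → ℕ) (a : Fin (k + i + 1)) (hka : k < a) (hai : (a : ℕ) < i) :
    (shift lam c : Coord (k + i)) a = (lam : Coord (k + i)) a := by
  rw [shift_apply, Finset.sum_eq_zero, sub_zero]
  intro t _
  rw [if_neg (by omega), if_neg (by omega)]
  ring

theorem shift_injective {k i : ℕ} (hki : k < i) (lam : weightLattice (k + i)) :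
    Function.Injective (shift lam) := by
  intro c d h
  funext j
  have h' := congrArg (fun y : weightLattice (k + i) =>
    (y : Coord (k + i)) ⟨j, by omega⟩) h
  simp only [shift_apply_left hki lam _ j ⟨j, by omega⟩ rfl] at h'
  have : (c j : ℝ) = d j := by linarith
  exact_mod_cast this

theorem heightLE_iff_exists_shift {k i : ℕ} {mu lam : weightLattice (k + i)}
    (hi : 0 < i) : HeightLE i mu lam ↔ ∃ c, mu = shift lam c := by
  constructor
  · intro h
    suffices H : ∀ z ∈ AddSubmonoid.closure {z : weightLattice (k + i) |
        ∃ a b : Fin (k + i + 1), a < b ∧ ht (rootVec (k + i) a b) = i ∧ z = root (k + i) a b},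
        ∃ c : Fin (k + 1) → ℕ,
          z = ∑ j, c j • root (k + i) (heightRoot k i j).1 (heightRoot k i j).2 by
      obtain ⟨c, hc⟩ := H _ h
      exact ⟨c, by rw [shift, ← hc, sub_sub_cancel]⟩
    intro z hz
    induction hz using AddSubmonoid.closure_induction with
    | mem z hz =>
      obtain ⟨a, b, -, hh, rfl⟩ := hz
      rw [ht_root, sub_eq_iff_eq_add'] at hh
      have hb : (b : ℕ) = a + i := by exact_mod_cast hh
      refine ⟨Pi.single ⟨a, by omega⟩ 1, ?_⟩
      rw [Finset.sum_eq_single (⟨a, by omega⟩ : Fin (k + 1)) (fun t _ ht => by simp [ht])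
        (by simp), Pi.single_eq_same, one_nsmul]
      exact congrArg₂ _ rfl (Fin.ext hb)
    | zero => exact ⟨0, by simp⟩
    | add y z _ _ hy hz =>
      obtain ⟨c, rfl⟩ := hy
      obtain ⟨d, rfl⟩ := hz
      exact ⟨c + d, by simp [add_nsmul, Finset.sum_add_distrib]⟩
  · rintro ⟨c, rfl⟩
    rw [HeightLE, shift, sub_sub_cancel]
    refine sum_mem fun j _ => nsmul_mem (AddSubmonoid.subset_closure ?_) _
    refine ⟨_, _, ?_, ?_, rfl⟩
    · exact Fin.lt_def.2 (by simp only [heightRoot]; omega)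
    · rw [ht_root]
      simp [heightRoot]

theorem ht_sub_shift {k i : ℕ} (lam : weightLattice (k + i)) (c : Fin (k + 1) → ℕ) :
    ht ((lam - shift lam c : weightLattice (k + i)) : Coord (k + i)) =
      i * ((∑ j, c j : ℕ) : ℝ) := by
  let f : weightLattice (k + i) →+ ℝ := AddMonoidHom.mk' (fun x => ht (x : Coord (k + i)))
    fun x y => by simp [ht, Finset.sum_add_distrib]
  have hroot : ∀ j, f (root (k + i) (heightRoot k i j).1 (heightRoot k i j).2) = i := by
    intro j
    change ht (rootVec _ _ _) = _
    rw [ht_root]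
    simp [heightRoot]
  change f (lam - shift lam c) = _
  rw [shift, sub_sub_cancel, map_sum]
  simp only [map_nsmul, hroot, nsmul_eq_mul, Nat.cast_sum, Finset.mul_sum]
  exact Finset.sum_congr rfl fun j _ => mul_comm _ _

theorem posRootsGE_eq_union {k i : ℕ} (hi : 0 < i) :
    posRootsGE (k + i) i = posRootsGE (k + i) (i + 1) ∪ Finset.univ.image (heightRoot k i) := by
  ext p
  rw [Finset.mem_union, mem_posRootsGE hi, mem_posRootsGE (Nat.succ_pos i), Finset.mem_image]
  constructor
  · intro h
    rcases h.eq_or_lt with h | h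
    · refine Or.inr ⟨⟨p.1, by omega⟩, Finset.mem_univ _, ?_⟩
      exact Prod.ext rfl (Fin.ext h)
    · exact Or.inl (by omega)
  · rintro (h | ⟨j, -, rfl⟩)
    · omega
    · exact le_rfl

/-! ### The walls of the dominant region -/

/-- The gaps `lam_a - lam_{a+1}` of the coordinates of a dominant weight that enter the walls for
the vectors `c`: `L` in the first block of `k + 1` coordinates, `B` at its end, `A` before the
last block of `k + 1` coordinates, and `R` inside it. -/
structure HasGaps {k i : ℕ} (hki : k + 2 ≤ i) (lam : weightLattice (k + i)) (A B : ℕ)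
    (L R : Fin k → ℕ) : Prop where
  first : (lam : Coord (k + i)) ⟨i - 1, by omega⟩ = (lam : Coord (k + i)) ⟨i, by omega⟩ + A
  last : (lam : Coord (k + i)) ⟨k, by omega⟩ = (lam : Coord (k + i)) ⟨k + 1, by omega⟩ + B
  left : ∀ j : Fin k, (lam : Coord (k + i)) ⟨j, by omega⟩ =
    (lam : Coord (k + i)) ⟨j + 1, by omega⟩ + L j
  right : ∀ j : Fin k, (lam : Coord (k + i)) ⟨j + i, by omega⟩ =
    (lam : Coord (k + i)) ⟨j + i + 1, by omega⟩ + R j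

theorem IsDominant.exists_hasGaps {k i : ℕ} (hki : k + 2 ≤ i) {lam : weightLattice (k + i)}
    (hlam : IsDominant lam) : ∃ A B L R, HasGaps hki lam A B L R := by
  have gap : ∀ a b : Fin (k + i + 1), ∃ l : ℕ, a < b →
      (lam : Coord (k + i)) a = (lam : Coord (k + i)) b + l := by
    intro a b
    by_cases hab : a < b
    · obtain ⟨m, hm⟩ := lam.2.2 a b
      have h0 := hlam a b hab
      rw [hm] at h0
      obtain ⟨l, rfl⟩ := Int.eq_ofNat_of_zero_le (show 0 ≤ m by exact_mod_cast h0)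
      refine ⟨l, fun _ => ?_⟩
      simp only [pairing] at hm
      push_cast at hm
      linarith
    · exact ⟨0, fun h => absurd h hab⟩
  choose l hl using gap
  exact ⟨_, _, _, _, hl _ _ (Fin.lt_def.2 (by simp only; omega)),
    hl _ _ (Fin.lt_def.2 (by simp only; omega)),
    fun j => hl _ _ (Fin.lt_def.2 (by simp only; omega)),
    fun j => hl _ _ (Fin.lt_def.2 (by simp only; omega))⟩

section

variable {k i : ℕ} {hki : k + 2 ≤ i} {lam : weightLattice (k + i)} {A B : ℕ} {L R : Fin k → ℕ}

theorem HasGaps.isDominant_shift_iff (h : HasGaps hki lam A B L R) (hlam : IsDominant lam)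
    (c : Fin (k + 1) → ℕ) : IsDominant (shift lam c) ↔ IsAdmissible A B L R c := by
  have hlt : k < i := by omega
  have hA : (shift lam c : Coord (k + i)) ⟨i, by omega⟩ ≤
      (shift lam c : Coord (k + i)) ⟨i - 1, by omega⟩ ↔ c 0 ≤ A := by
    rw [shift_apply_right hlt lam c 0 _ (by simp),
      shift_apply_middle lam c _ (by simp only; omega) (by simp only; omega), h.first,
      add_le_add_iff_left, Nat.cast_le]
  have hB : (shift lam c : Coord (k + i)) ⟨k + 1, by omega⟩ ≤
      (shift lam c : Coord (k + i)) ⟨k, by omega⟩ ↔ c (Fin.last k) ≤ B := by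
    rw [shift_apply_left hlt lam c (Fin.last k) ⟨k, by omega⟩ (by simp),
      shift_apply_middle lam c _ (by simp only; omega) (by simp only; omega), h.last,
      le_sub_iff_add_le, add_le_add_iff_left, Nat.cast_le]
  have hL : ∀ j : Fin k, (shift lam c : Coord (k + i)) ⟨j + 1, by omega⟩ ≤
      (shift lam c : Coord (k + i)) ⟨j, by omega⟩ ↔ c j.castSucc ≤ c j.succ + L j := by
    intro j
    rw [shift_apply_left hlt lam c j.castSucc ⟨j, by omega⟩ (by simp),
      shift_apply_left hlt lam c j.succ ⟨j + 1, by omega⟩ (by simp), h.left, ← Nat.cast_le (α := ℝ)]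
    push_cast
    constructor <;> intro h <;> linarith
  have hR : ∀ j : Fin k, (shift lam c : Coord (k + i)) ⟨j + i + 1, by omega⟩ ≤
      (shift lam c : Coord (k + i)) ⟨j + i, by omega⟩ ↔ c j.succ ≤ c j.castSucc + R j := by
    intro j
    rw [shift_apply_right hlt lam c j.castSucc ⟨j + i, by omega⟩ (by simp),
      shift_apply_right hlt lam c j.succ ⟨j + i + 1, by omega⟩ (by simp; omega), h.right,
      ← Nat.cast_le (α := ℝ)]
    push_cast
    constructor <;> intro h <;> linarith
  rw [isDominant_iff_succ_le, IsAdmissible, ← hA, ← hB]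
  simp only [← hL, ← hR]
  constructor
  · intro hd
    have hd' : ∀ (a : ℕ) (ha : a < k + i), (shift lam c : Coord (k + i)) ⟨a + 1, by omega⟩ ≤
        (shift lam c : Coord (k + i)) ⟨a, by omega⟩ := fun a ha => hd ⟨a, ha⟩
    refine ⟨?_, hd' k (by omega), fun j => ⟨hd' (j + i) (by omega), hd' j (by omega)⟩⟩
    have := hd' (i - 1) (by omega)
    simpa only [Nat.sub_add_cancel (show 1 ≤ i by omega)] using this
  · rintro ⟨h1, h2, h3⟩ ⟨a, ha⟩
    rcases lt_trichotomy a k with hak | rfl | hak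
    · exact (h3 ⟨a, hak⟩).2
    · exact h2
    rcases lt_trichotomy (a + 1) i with hai | rfl | hai
    · rw [shift_apply_middle lam c (Fin.succ _) (by simp; omega) (by simpa using hai),
        shift_apply_middle lam c (Fin.castSucc _) (by simpa using hak) (by simp; omega)]
      exact isDominant_iff_succ_le.1 hlam _
    · exact h1
    · obtain ⟨j, rfl⟩ := Nat.exists_eq_add_of_le' (show i ≤ a by omega)
      exact (h3 ⟨j, by omega⟩).1

variable {M : Type*} [AddCommGroup M] [Module Scalars M] {T : weightLattice (k + i) → M}

/-- Outside the walls the weight `lam - ∑_j d_j γ_j` lies on a reflection hyperplane. The roots of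
height greater than `i` are stable under the reflection for the two end walls, and stable except
for one root of height `i + 1` for the other walls. -/
theorem HasGaps.isWallCompatible (h : HasGaps hki lam A B L R) (hT : IsDotAlternating T) :
    IsWallCompatible A B L R fun d =>
      q ^ (∑ j, d j) • rootSum T (posRootsGE (k + i) (i + 1)) (shift lam d) := by
  have hlt : k < i := by omega
  have hsum : ∀ (d : Fin (k + 1) → ℕ) (j : Fin (k + 1)),
      ∑ t, Function.update d j (d j + 1) t = ∑ t, d t + 1 := by
    intro d j
    simpa only [smul_eq_mul, mul_one] using sum_update_add_one_nsmul d j fun _ => (1 : ℕ)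
  have hmem : ∀ p, p ∈ posRootsGE (k + i) (i + 1) ↔ (p.1 : ℕ) + (i + 1) ≤ p.2 :=
    mem_posRootsGE (Nat.succ_pos i)
  refine ⟨fun d hd => ?_, fun d hd => ?_, fun j d hd => ?_, fun j d hd => ?_⟩
  · rw [hT.rootSum_singular (a := ⟨i - 1, by omega⟩) (b := ⟨i, by omega⟩)
      (by simp [Fin.ext_iff]; omega), smul_zero]
    · refine isStable_swap fun p hp => ?_
      rw [hmem] at hp ⊢
      simp only [Equiv.swap_apply_def, Fin.ext_iff]
      split_ifs <;> omega
    · rw [add_rho_apply, add_rho_apply, shift_apply_right hlt lam d 0 ⟨i, by omega⟩ (by simp),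
        shift_apply_middle lam d _ (by simp only; omega) (by simp only; omega), h.first, hd]
      simp only
      push_cast [Nat.cast_sub (show 1 ≤ i by omega)]
      ring
  · rw [hT.rootSum_singular (a := ⟨k, by omega⟩) (b := ⟨k + 1, by omega⟩)
      (by simp [Fin.ext_iff]), smul_zero]
    · refine isStable_swap fun p hp => ?_
      rw [hmem] at hp ⊢
      simp only [Equiv.swap_apply_def, Fin.ext_iff]
      split_ifs <;> omega
    · rw [add_rho_apply, add_rho_apply,
        shift_apply_left hlt lam d (Fin.last k) ⟨k, by omega⟩ (by simp),
        shift_apply_middle lam d _ (by simp only; omega) (by simp only; omega), h.last, hd]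
      push_cast
      ring
  · rw [shift_update, hsum, pow_succ, mul_smul]
    congr 1
    have hne : (⟨j + i, by omega⟩ : Fin (k + i + 1)) ≠ ⟨j + i + 1, by omega⟩ := by
      simp [Fin.ext_iff]
    rw [hT.rootSum_eq_smul (p := (⟨j, by omega⟩, ⟨j + i + 1, by omega⟩)) hne
      ((hmem _).2 (by simp only; omega)), Equiv.swap_apply_right,
      Equiv.swap_apply_of_ne_of_ne (by simp [Fin.ext_iff]; omega) (by simp [Fin.ext_iff]; omega)]
    · rfl
    · refine isStable_swap fun p hp => ?_
      rw [Finset.mem_erase, hmem] at hp ⊢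
      simp only [Equiv.swap_apply_def, Fin.ext_iff, Prod.ext_iff, ne_eq] at hp ⊢
      split_ifs <;> (try dsimp only) <;> omega
    · rw [add_rho_apply, add_rho_apply,
        shift_apply_right hlt lam d j.castSucc ⟨j + i, by omega⟩ (by simp),
        shift_apply_right hlt lam d j.succ ⟨j + i + 1, by omega⟩ (by simp; omega), h.right, hd]
      push_cast
      ring
  · rw [shift_update, hsum, pow_succ, mul_smul]
    congr 1
    have hne : (⟨j, by omega⟩ : Fin (k + i + 1)) ≠ ⟨j + 1, by omega⟩ := by
      simp [Fin.ext_iff]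
    rw [hT.rootSum_eq_smul (p := (⟨j, by omega⟩, ⟨j + i + 1, by omega⟩)) hne
      ((hmem _).2 (by simp only; omega)), Equiv.swap_apply_left,
      Equiv.swap_apply_of_ne_of_ne (by simp [Fin.ext_iff]; omega) (by simp [Fin.ext_iff]; omega)]
    · have hsnd : (heightRoot k i j.succ).2 = ⟨j + i + 1, by omega⟩ :=
        Fin.ext (by simp only [heightRoot, Fin.val_succ]; omega)
      rw [hsnd]
      rfl
    · refine isStable_swap fun p hp => ?_
      rw [Finset.mem_erase, hmem] at hp ⊢
      simp only [Equiv.swap_apply_def, Fin.ext_iff, Prod.ext_iff, ne_eq] at hp ⊢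
      split_ifs <;> (try dsimp only) <;> omega
    · rw [add_rho_apply, add_rho_apply,
        shift_apply_left hlt lam d j.castSucc ⟨j, by omega⟩ (by simp),
        shift_apply_left hlt lam d j.succ ⟨j + 1, by omega⟩ (by simp), h.left, hd]
      push_cast
      ring

/-- The expansion, as a sum over the admissible vectors `c`. -/
theorem HasGaps.preCanonical_succ (h : HasGaps hki lam A B L R) (C : Finset (Fin (k + 1) → ℕ))
    (hC : ∀ c, c ∈ C ↔ IsAdmissible A B L R c) :
    preCanonical (i + 1) lam = ∑ c ∈ C, q ^ (∑ j, c j) • preCanonical i (shift lam c) := by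
  have hi : 0 < i := by omega
  have hw := h.isWallCompatible (isDotAlternating_klTilde (k + i))
  have h0 := sum_iteratedDiff hw C hC
  simp only [shift_zero, Pi.zero_apply, Finset.sum_const_zero, pow_zero, one_smul] at h0
  rw [preCanonical_eq_rootSum, ← h0]
  refine Finset.sum_congr rfl fun c _ => ?_
  rw [preCanonical_eq_rootSum, posRootsGE_eq_union hi]
  refine (smul_rootSum_union _ _ (heightRoot k i) heightRoot_injective (fun j hj => ?_) lam c).symm
  rw [mem_posRootsGE (Nat.succ_pos i)] at hj
  simp only [heightRoot] at hj
  omega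

end

end PreCanonical

theorem mainTheorem3 (n i : ℕ) (hi : (n : ℚ) / 2 + 1 ≤ i) (hin : i ≤ n)
    (lam : PreCanonical.weightLattice n) (hlam : PreCanonical.IsDominant lam) :
    ∃ (hfin : {mu | PreCanonical.IsDominant mu ∧ PreCanonical.HeightLE i mu lam}.Finite)
      (e : PreCanonical.weightLattice n → ℕ),
      (∀ mu, PreCanonical.IsDominant mu → PreCanonical.HeightLE i mu lam →
        PreCanonical.ht ((lam - mu : PreCanonical.weightLattice n) : PreCanonical.Coord n) =
          i * e mu) ∧
      PreCanonical.preCanonical (i + 1) lam =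
        ∑ mu ∈ hfin.toFinset, PreCanonical.q ^ e mu • PreCanonical.preCanonical i mu := by
  classical
  open PreCanonical in
  obtain ⟨k, rfl⟩ := Nat.exists_eq_add_of_le' hin
  -- At least one coordinate lies strictly between the first and the last block of `k + 1`.
  have hki : k + 2 ≤ i := by
    have h : ((k + 2 : ℕ) : ℚ) ≤ i := by
      push_cast at hi ⊢
      linarith
    exact_mod_cast h
  have hpos : 0 < i := by omega
  obtain ⟨A, B, L, R, hg⟩ := hlam.exists_hasGaps hki
  have hset : {mu | IsDominant mu ∧ HeightLE i mu lam} =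
      shift lam '' {c | IsAdmissible A B L R c} := by
    ext mu
    constructor
    · rintro ⟨h1, h2⟩
      obtain ⟨c, rfl⟩ := (heightLE_iff_exists_shift hpos).1 h2
      exact ⟨c, (hg.isDominant_shift_iff hlam c).1 h1, rfl⟩
    · rintro ⟨c, hc, rfl⟩
      exact ⟨(hg.isDominant_shift_iff hlam c).2 hc, (heightLE_iff_exists_shift hpos).2 ⟨c, rfl⟩⟩
  have hadm := finite_isAdmissible A B L R
  have hfin : {mu | IsDominant mu ∧ HeightLE i mu lam}.Finite := hset ▸ hadm.image _
  have he : ∀ c : Fin (k + 1) → ℕ,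
      ⌊ht ((lam - shift lam c : weightLattice (k + i)) : Coord (k + i)) / i⌋₊ = ∑ j, c j := by
    intro c
    rw [ht_sub_shift, mul_div_cancel_left₀ _ (by positivity), Nat.floor_natCast]
  refine ⟨hfin, fun mu => ⌊ht ((lam - mu : weightLattice (k + i)) : Coord (k + i)) / i⌋₊, ?_, ?_⟩
  · intro mu _ h
    obtain ⟨c, rfl⟩ := (heightLE_iff_exists_shift hpos).1 h
    beta_reduce
    rw [he, ht_sub_shift]
  · have himage : hfin.toFinset = hadm.toFinset.image (shift lam) := by
      ext mu
      rw [Set.Finite.mem_toFinset, hset, Finset.mem_image]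
      simp only [Set.Finite.mem_toFinset]
      rfl
    rw [himage, Finset.sum_image fun c _ d _ hcd => shift_injective (by omega) lam hcd,
      hg.preCanonical_succ hadm.toFinset fun c => hadm.mem_toFinset]
    refine Finset.sum_congr rfl fun c _ => ?_
    beta_reduce
    rw [he]
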